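/- Let $\mu>0$, $L_\infty>0$ and $\mathbb R^3_+=\{(x,y,z)\in\mathbb R^3: z>0\}$. Let $\boldsymbol\xi$ be a three-component Gaussian white noise on $\mathbb R^3_+$, and let $\kappa\in\mathbb R\cup\{\infty\}$. Let $A=\mathrm{Id}-L_\infty^2\Delta$ be the operator on $[L^2(\mathbb R^3_+)]^3$ whose domain consists of all $\boldsymbol\psi\in[H^2(\mathbb R^3_+)]^3$ satisfying, in the sense of traces, $\psi_1=\psi_2=0$ and $\kappa\psi_3+L_\infty^2\,\partial\psi_3/\partial z=0$ at $z=0$ (for $\kappa=\infty$ the last condition reads $\psi_3=0$). Let the generalized random vector field $\boldsymbol\psi$ be any solution of the half-space von Kármán model with constant length scales $L_1=L_2=L_3=L_\infty$, $$A^{17/12}\boldsymbol\psi=\mu L_\infty^{17/6}\boldsymbol\xi ,$$ where the equation presupposes that $A$ is non-negative and self-adjoint, the fractional power is defined by the spectral theorem, and $\boldsymbol\psi$ is a continuous linear map from $[L^2(\mathbb R^3_+)]^3$ to the square-integrable random variables with $\langle\boldsymbol\psi,A^{17/12}\boldsymbol\varphi\rangle=\mu L_\infty^{17/6}\langle\boldsymbol\xi,\boldsymbol\varphi\rangle$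 for all $\boldsymbol\varphi$ in the domain of $A^{17/12}$. Set $\mathbf u=(u,v,w)=\nabla\times\boldsymbol\psi$ in the sense of distributions. Then $w$ is represented by a mean-square continuous random field on $\mathbb R^3_+$, and its Reynolds stress $\langle w^2\rangle$ (the expectation of $w^2$ at a point) has the following properties. 1. As $z\to\infty$ with $(x,y)$ fixed, $\langle w^2\rangle$ converges to a limit $\langle w_\infty^2\rangle>0$, which depends only on $\mu$ and $L_\infty$ and, in particular, not on $\kappa$. 2. For every $(x,y,z)$ with $z>0$, $$\frac{\langle w^2\rangle}{\langle w_\infty^2\rangle}=1-\mathcal M_{1/3}\!\left(\frac{2z}{L_\infty}\right),\qquad \mathcal M_\nu(x)=\frac{x^\nu K_\nu(x)}{2^{\nu-1}\Gamma(\nu)},$$ where $K_\nu$ is the modified Bessel function of the second kind; the right-hand side does not involve $\kappa$. 3. Near the boundary, $$\frac{\langle w^2\rangle}{\langle w_\infty^2\rangle}\sim\frac{\Gamma(2/3)}{\Gamma(4/3)}\left(\frac{z}{L_\infty}\right)^{2/3}\qquad\text{as } \frac{z}{L_\infty}\to0^+ .$$ -/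

import Mathlib

open MeasureTheory ProbabilityTheory Filter Topology Asymptotics
open scoped ContDiff

namespace VonKarman

/-- Physical space with the Euclidean norm; the coordinates `x 0, x 1, x 2` are `x, y, z`. -/
abbrev Space : Type := EuclideanSpace ℝ (Fin 3)

/-- The open half-space `z > 0`. -/
def halfSpace : Set Space := {x | 0 < x 2}

/-- Lebesgue measure on the half-space. -/
noncomputable abbrev halfVol : Measure Space := volume.restrict halfSpace

/-- Real scalar `L²` of the half-space. -/
abbrev L2 : Type := Lp ℝ 2 halfVol

/-- The Hilbert space `[L²]³` of square-integrable vector fields on the half-space. -/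
abbrev L2Vec : Type := PiLp 2 (fun _ : Fin 3 => L2)

/-- The partial derivative `∂ᵢ φ`. -/
noncomputable def partialDeriv (i : Fin 3) (φ : Space → ℝ) (x : Space) : ℝ :=
  fderiv ℝ φ x (EuclideanSpace.single i 1)

/-- Smooth functions with compact support contained in `U`. -/
def IsTest (U : Set Space) (φ : Space → ℝ) : Prop :=
  ContDiff ℝ ∞ φ ∧ HasCompactSupport φ ∧ tsupport φ ⊆ U

/-- `g` is the weak derivative `∂ᵢ f` on the half-space. -/
def HasWeakDeriv (i : Fin 3) (f g : L2) : Prop :=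
  ∀ φ : Space → ℝ, IsTest halfSpace φ →
    ∫ x in halfSpace, f x * partialDeriv i φ x = - ∫ x in halfSpace, g x * φ x

/-- For `f` in `H¹` of the half-space with weak derivative `f₃ = ∂f/∂z`, the trace of `f` on
`z = 0` vanishes: the boundary term of Green's formula
`∫ (f ∂φ/∂z + f₃ φ) = - ∫_{z = 0} (tr f) φ` is zero for every smooth compactly supported `φ` on
the whole space. -/
def TraceZero (f f₃ : L2) : Prop :=
  ∀ φ : Space → ℝ, IsTest Set.univ φ →
    ∫ x in halfSpace, (f x * partialDeriv 2 φ x + f₃ x * φ x) = 0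

/-- The graph of the operator `A = Id - div (Θ ∇)` on `[L²]³`, where
`Θ = diag (ℓ₁², ℓ₂², ℓ₃²)` is constant.  Its domain consists of the vector fields `ψ` in `[H²]³`
such that, in the sense of traces at `z = 0`, one has `ψ₁ = ψ₂ = 0` and
`κ ψ₃ + ℓ₃² ∂ψ₃/∂z = 0` (to be read as `ψ₃ = 0` when `κ = ∞`).
Here `g c i = ∂ᵢ ψ_c` and `h c i j = ∂ⱼ ∂ᵢ ψ_c`. -/
def operatorGraph (ℓ : Fin 3 → ℝ) (κ : WithTop ℝ) : Set (L2Vec × L2Vec) :=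
  {p | ∃ (g : Fin 3 → Fin 3 → L2) (h : Fin 3 → Fin 3 → Fin 3 → L2),
    (∀ c i, HasWeakDeriv i (p.1 c) (g c i)) ∧
    (∀ c i j, HasWeakDeriv j (g c i) (h c i j)) ∧
    TraceZero (p.1 0) (g 0 2) ∧
    TraceZero (p.1 1) (g 1 2) ∧
    (κ = ⊤ → TraceZero (p.1 2) (g 2 2)) ∧
    (∀ k : ℝ, κ = (k : WithTop ℝ) →
      TraceZero (k • p.1 2 + (ℓ 2) ^ 2 • g 2 2) (k • g 2 2 + (ℓ 2) ^ 2 • h 2 2 2)) ∧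
    ∀ c, p.2 c = p.1 c - ∑ i, (ℓ i) ^ 2 • h c i i}

/-- A spectral representation of an operator `A ≥ 0` on `[L²]³` with graph `G`: a unitary map `U`
onto some `L²(Y, ν)`, `ν` finite, that turns `A` into the multiplication by a measurable function
`lam ≥ 0`, with `φ` in the domain of `A` exactly when `lam · U φ` is square-integrable. -/
structure SpectralRep (G : Set (L2Vec × L2Vec)) where
  Y : Type
  [measY : MeasurableSpace Y]
  ν : Measure Y
  [finite : IsFiniteMeasure ν]
  lam : Y → ℝ
  measurable_lam : Measurable lam
  lam_nonneg : ∀ᵐ y ∂ν, 0 ≤ lam y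
  U : L2Vec ≃ₗᵢ[ℝ] Lp ℝ 2 ν
  mem_graph_iff : ∀ φ f : L2Vec, (φ, f) ∈ G ↔ ⇑(U f) =ᵐ[ν] fun y => lam y * U φ y

/-- The graph of the fractional power `A^α = U* lam^α U`, with its natural domain. -/
def SpectralRep.powGraph {G : Set (L2Vec × L2Vec)} (S : SpectralRep G) (α : ℝ) :
    Set (L2Vec × L2Vec) :=
  letI := S.measY
  {p | ⇑(S.U p.2) =ᵐ[S.ν] fun y => S.lam y ^ α * S.U p.1 y}

section Random

variable {Ω : Type*} [MeasurableSpace Ω] {P : Measure Ω}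

/-- `ξ` is a (three-component) Gaussian white noise on the half-space: a linear family of random
variables such that `ξ f` is centred Gaussian with variance `‖f‖²`. -/
def IsWhiteNoise (ξ : L2Vec →L[ℝ] Lp ℝ 2 P) : Prop :=
  ∀ f : L2Vec, P.map (ξ f) = gaussianReal 0 (‖f‖₊ ^ 2)

/-- The generalized random vector field `Ψ` on the half-space (`Ψ f` stands for `∫ ψ · f`) solves
`(Id - div (Θ ∇))^α ψ = μ L^{2α} ξ`, with `α = 17/12`, `Θ = diag (ℓ₁², ℓ₂², ℓ₃²)`,
`L = (ℓ₁ ℓ₂ ℓ₃)^{1/3}` and the boundary conditions `ψ₁ = ψ₂ = κ ψ₃ + ℓ₃² ∂ψ₃/∂z = 0` at `z = 0`.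
The equation is understood in the weak sense `⟨ψ, A^α φ⟩ = μ L^{2α} ⟨ξ, φ⟩` for every `φ` in the
domain of the self-adjoint operator `A^α`. -/
def IsSolution (ℓ : Fin 3 → ℝ) (κ : WithTop ℝ) (μ : ℝ) (ξ Ψ : L2Vec →L[ℝ] Lp ℝ 2 P) : Prop :=
  ∃ S : SpectralRep (operatorGraph ℓ κ), ∀ φ f : L2Vec, (φ, f) ∈ S.powGraph (17 / 12) →
    Ψ f = (μ * ((∏ i, ℓ i) ^ (1 / 3 : ℝ)) ^ (17 / 6 : ℝ)) • ξ φ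

/-- The classical curl of a vector field. -/
noncomputable def curl (F : Fin 3 → Space → ℝ) : Fin 3 → Space → ℝ :=
  ![fun x => partialDeriv 1 (F 2) x - partialDeriv 2 (F 1) x,
    fun x => partialDeriv 2 (F 0) x - partialDeriv 0 (F 2) x,
    fun x => partialDeriv 0 (F 1) x - partialDeriv 1 (F 0) x]

/-- `w` is the `j`-th component of `u = ∇ × ψ` as a genuine random field: a mean-square continuous
field on the half-space which coincides with the `j`-th component of the distributional curl of the
generalized random field `Ψ`, that is, `∫ φ w = ⟨ψ, ∇ × (φ e_j)⟩` for all test functions `φ`. -/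
def IsCurlComponent (Ψ : L2Vec →L[ℝ] Lp ℝ 2 P) (j : Fin 3) (w : Space → Lp ℝ 2 P) : Prop :=
  ContinuousOn w halfSpace ∧
  ∀ φ : Space → ℝ, IsTest halfSpace φ → ∀ η : L2Vec,
    (∀ c, ⇑(η c) =ᵐ[halfVol] curl (Pi.single j φ) c) →
      ∫ x in halfSpace, φ x • w x = Ψ η

/-- The Reynolds stress `⟨w²⟩` at the point `x`. -/
noncomputable def reynoldsStress (w : Space → Lp ℝ 2 P) (x : Space) : ℝ :=
  ∫ a, (w x a) ^ 2 ∂P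

end Random

/-- The modified Bessel function of the second kind `K_ν(x)`, for `x > 0`. -/
noncomputable def besselK (ν x : ℝ) : ℝ :=
  ∫ t in Set.Ioi (0 : ℝ), Real.exp (-x * Real.cosh t) * Real.cosh (ν * t)

/-- The Matérn kernel `x^ν K_ν(x) / (2^{ν-1} Γ(ν))`, for `x > 0` and `ν > 0`. -/
noncomputable def matern (ν x : ℝ) : ℝ :=
  x ^ ν * besselK ν x / (2 ^ (ν - 1) * Real.Gamma ν)

end VonKarman

open scoped SchwartzMap FourierTransform LineDeriv ComplexConjugate InnerProductSpace

namespace VonKarman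

/-! Only the two horizontal components of `ψ` enter `w`, and both satisfy Dirichlet conditions;
tested against `φ`, `w` is `Ψ` applied to `∇ × (φ e₃)`, whose third component is zero. The condition
involving `κ` is therefore never seen.

The Dirichlet problem is solved by images. An odd Schwartz function vanishes on the boundary and the
symbol of `Id - L² Δ` is invariant under reflection, so restrictions of odd functions carry the
resolvent of `A` as a Fourier multiplier (`emb_bessel_mem_operatorGraph`). The spectral
representation is arbitrary, so the fractional power is identified by approximating `x ^ α` on `[0,
1]` by polynomials in the resolvent (`ae_eq_rpow_mul`, `emb_bessel_mem_powGraph`).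

Hence `w x` is, up to the noise strength, `ξ` applied to `fieldKernel`: horizontal derivatives of
the whole-space kernel centred at `x` minus those of the kernel centred at the mirror point. White
noise is an isometry, an odd real field has half its energy in the half-space, and Plancherel leaves
an integral of `symb ^ (-17/6)` against `k_j² (2 - 2 cos (4π z k_2))`. Writing the power as a Gamma
integral makes the `k`-integral Gaussian and gives a constant times `varInt (z / L)`
(`norm_imageHat_sq_eq`). In `varInt` the term `1` yields the limit `Γ(1/3)`, the exponential yields
the Matérn term (`varInt_eq_matern`), and the substitution `t = s² / r` exposes the power `2/3` at
the boundary (`tendsto_varInt_div_rpow`). -/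

/-! ### Reflection, Fourier multipliers and odd Schwartz functions on the whole space. -/

/-- The reflection `z ↦ -z`. -/
noncomputable def reflect : Space ≃ₗᵢ[ℝ] Space :=
  LinearIsometryEquiv.piLpCongrRight 2
    (fun i => if i = 2 then LinearIsometryEquiv.neg ℝ else LinearIsometryEquiv.refl ℝ ℝ)

lemma reflect_apply (x : Space) (i : Fin 3) : reflect x i = if i = 2 then -x i else x i := by
  unfold reflect
  rw [LinearIsometryEquiv.piLpCongrRight_apply]
  dsimp only
  split_ifs <;> simp

lemma reflect_reflect (x : Space) : reflect (reflect x) = x := by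
  ext i
  simp only [reflect_apply]
  split_ifs <;> simp

/-- The symbol `1 + L² |2πk|²` of `Id - L² Δ`. -/
noncomputable def symb (L : ℝ) (k : Space) : ℝ := 1 + ‖(2 * Real.pi * L) • k‖ ^ 2

lemma one_le_symb (L : ℝ) (k : Space) : 1 ≤ symb L k := by
  unfold symb; nlinarith [sq_nonneg ‖(2 * Real.pi * L) • k‖]

lemma symb_pos (L : ℝ) (k : Space) : 0 < symb L k := one_pos.trans_le (one_le_symb L k)

lemma symb_eq (L : ℝ) (k : Space) : symb L k = 1 + (2 * Real.pi * L) ^ 2 * ‖k‖ ^ 2 := by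
  rw [symb, norm_smul, mul_pow, Real.norm_eq_abs, sq_abs]

lemma symb_reflect (L : ℝ) (k : Space) : symb L (reflect k) = symb L k := by
  simp only [symb_eq, LinearIsometryEquiv.norm_map]

lemma symb_neg (L : ℝ) (k : Space) : symb L (-k) = symb L k := by
  simp only [symb_eq, norm_neg]

lemma continuous_symb (L : ℝ) : Continuous (symb L) := by unfold symb; fun_prop

lemma continuous_symb_rpow (L s : ℝ) : Continuous fun k => symb L k ^ s :=
  (continuous_symb L).rpow_const fun k => Or.inl (symb_pos L k).ne'

lemma hasTemperateGrowth_symb_rpow (L s : ℝ) :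
    (fun k : Space => symb L k ^ s).HasTemperateGrowth :=
  (Function.hasTemperateGrowth_one_add_norm_sq_rpow Space s).comp
    (((2 * Real.pi * L) • ContinuousLinearMap.id ℝ Space).hasTemperateGrowth)

lemma hasTemperateGrowth_symb_rpow_ofReal (L s : ℝ) :
    (fun k : Space => ((symb L k ^ s : ℝ) : ℂ)).HasTemperateGrowth :=
  Function.HasTemperateGrowth.comp Function.Complex.hasTemperateGrowth_ofReal
    (hasTemperateGrowth_symb_rpow L s)

/-- The Fourier multiplier `(Id - L² Δ)^{-s}` on Schwartz functions on the whole space. -/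
noncomputable def bessel (L s : ℝ) : 𝓢(Space, ℂ) →L[ℂ] 𝓢(Space, ℂ) :=
  SchwartzMap.fourierMultiplierCLM ℂ (fun k => ((symb L k ^ (-s) : ℝ) : ℂ))

lemma fourier_bessel_apply (L s : ℝ) (f : 𝓢(Space, ℂ)) (k : Space) :
    (𝓕 (bessel L s f)) k = ((symb L k ^ (-s) : ℝ) : ℂ) * (𝓕 f) k := by
  rw [bessel, SchwartzMap.fourierMultiplierCLM_apply,
    FourierTransform.fourier_fourierInv_eq (F := 𝓢(Space, ℂ)),
    SchwartzMap.smulLeftCLM_apply_apply (hasTemperateGrowth_symb_rpow_ofReal L _), smul_eq_mul]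

lemma schwartz_ext_fourier {f g : 𝓢(Space, ℂ)} (h : ∀ k, (𝓕 f) k = (𝓕 g) k) : f = g := by
  have h' : 𝓕 f = 𝓕 g := SchwartzMap.ext h
  rw [← FourierTransform.fourierInv_fourier_eq (F := 𝓢(Space, ℂ)) f, h',
    FourierTransform.fourierInv_fourier_eq (F := 𝓢(Space, ℂ))]

lemma fourier_lineDeriv_apply (f : 𝓢(Space, ℂ)) (i : Fin 3) (k : Space) :
    (𝓕 (∂_{(EuclideanSpace.single i (1 : ℝ) : Space)} f)) k =
      2 * Real.pi * Complex.I * (k i : ℂ) * (𝓕 f) k := by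
  have h : (fun k : Space =>
      (inner ℝ k (EuclideanSpace.single i (1 : ℝ) : Space))).HasTemperateGrowth := by fun_prop
  rw [SchwartzMap.fourier_lineDerivOp_eq, smul_apply,
    SchwartzMap.smulLeftCLM_apply_apply h, EuclideanSpace.inner_single_right]
  simp [mul_assoc]

/-- The resolvent identity `(Id - L² Δ) (Id - L² Δ)⁻¹ f = f`. -/
lemma bessel_one_sub_laplacian (L : ℝ) (f : 𝓢(Space, ℂ)) :
    bessel L 1 f - ∑ i : Fin 3, (L : ℂ) ^ 2 • ∂_{(EuclideanSpace.single i (1 : ℝ) : Space)}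
      (∂_{(EuclideanSpace.single i (1 : ℝ) : Space)} (bessel L 1 f)) = f := by
  refine schwartz_ext_fourier fun k => ?_
  have hs : (symb L k : ℂ) ≠ 0 := by exact_mod_cast (symb_pos L k).ne'
  have hk : ‖k‖ ^ 2 = k 0 ^ 2 + k 1 ^ 2 + k 2 ^ 2 := by
    simp [EuclideanSpace.norm_sq_eq, Fin.sum_univ_three]
  have hE : (symb L k : ℂ) = 1 + (2 * Real.pi * L) ^ 2 * ((k 0 : ℂ) ^ 2 + k 1 ^ 2 + k 2 ^ 2) := by
    rw [symb_eq, hk]; push_cast; ring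
  simp only [Fin.sum_univ_three, sub_eq_add_neg, FourierTransform.fourier_add,
    FourierTransform.fourier_neg, FourierTransform.fourier_smul, add_apply,
    neg_apply, smul_apply, fourier_lineDeriv_apply, fourier_bessel_apply,
    Real.rpow_neg_one, smul_eq_mul, Complex.ofReal_inv]
  field_simp
  rw [hE]
  linear_combination (-4 * (Real.pi : ℂ) ^ 2 * L ^ 2 * ((k 0 : ℂ) ^ 2 + k 1 ^ 2 + k 2 ^ 2))
    * (𝓕 f) k * Complex.I_sq

/-- Composition with the reflection. -/
noncomputable def reflectS : 𝓢(Space, ℂ) →L[ℂ] 𝓢(Space, ℂ) :=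
  SchwartzMap.compCLMOfContinuousLinearEquiv ℂ reflect.toContinuousLinearEquiv

@[simp]
lemma reflectS_apply (f : 𝓢(Space, ℂ)) (x : Space) : reflectS f x = f (reflect x) := rfl

lemma fourier_reflectS (f : 𝓢(Space, ℂ)) (k : Space) :
    (𝓕 (reflectS f)) k = (𝓕 f) (reflect k) :=
  Real.fourier_comp_linearIsometry reflect f k

/-- Odd Schwartz functions. -/
def IsOdd (f : 𝓢(Space, ℂ)) : Prop := ∀ x, f (reflect x) = -f x

lemma isOdd_iff_fourier {f : 𝓢(Space, ℂ)} : IsOdd f ↔ ∀ k, (𝓕 f) (reflect k) = -(𝓕 f) k := by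
  have h : IsOdd f ↔ reflectS f = -f := ⟨fun h => SchwartzMap.ext h, fun h x => by
    rw [← reflectS_apply, h]; rfl⟩
  rw [h]
  constructor
  · intro h k
    rw [← fourier_reflectS, h, FourierTransform.fourier_neg]; rfl
  · intro h
    refine schwartz_ext_fourier fun k => ?_
    rw [fourier_reflectS, h, FourierTransform.fourier_neg]; rfl

/-- The symbol depends only on `‖k‖`, so the multiplier commutes with the reflection. -/
lemma IsOdd.bessel {f : 𝓢(Space, ℂ)} (hf : IsOdd f) (L s : ℝ) : IsOdd (bessel L s f) := by
  rw [isOdd_iff_fourier] at hf ⊢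
  intro k
  rw [fourier_bessel_apply, fourier_bessel_apply, symb_reflect, hf]; ring

/-- The odd extension of a function supported in the half-space. -/
noncomputable def oddExt (f : 𝓢(Space, ℂ)) : 𝓢(Space, ℂ) := f - reflectS f

lemma isOdd_oddExt (f : 𝓢(Space, ℂ)) : IsOdd (oddExt f) := fun x => by
  simp [oddExt, reflect_reflect]

lemma fourier_oddExt (f : 𝓢(Space, ℂ)) (k : Space) :
    (𝓕 (oddExt f)) k = (𝓕 f) k - (𝓕 f) (reflect k) := by
  rw [oddExt, sub_eq_add_neg, FourierTransform.fourier_add, FourierTransform.fourier_neg,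
    add_apply, neg_apply, fourier_reflectS, ← sub_eq_add_neg]

/-! ### Passage from the whole space to `[L²]³` of the half-space. -/

/-- Real part and restriction to the half-space. -/
noncomputable def rest : Lp ℂ 2 (volume : Measure Space) →L[ℝ] L2 :=
  (LpToLpRestrictCLM Space ℝ ℝ volume 2 halfSpace) ∘L (Complex.reCLM.compLpL 2 volume)

lemma coeFn_rest (u : Lp ℂ 2 (volume : Measure Space)) :
    rest u =ᵐ[halfVol] fun x => (u x).re := by
  have h1 := LpToLpRestrictCLM_coeFn ℝ halfSpace (Complex.reCLM.compLpL 2 volume u)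
  have h2 := ae_restrict_of_ae (s := halfSpace) (Complex.reCLM.coeFn_compLpL u)
  filter_upwards [h1, h2] with x h1 h2
  simp only [rest, ContinuousLinearMap.comp_apply] at *
  rw [h1, h2]; rfl

lemma coeFn_rest_toLp (f : 𝓢(Space, ℂ)) :
    rest (f.toLp 2) =ᵐ[halfVol] fun x => (f x).re := by
  filter_upwards [coeFn_rest (f.toLp 2), ae_restrict_of_ae (s := halfSpace) (f.coeFn_toLp 2 volume)]
    with x h1 h2
  rw [h1, h2]

lemma measurableSet_halfSpace : MeasurableSet halfSpace :=
  measurableSet_lt measurable_const (by fun_prop)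

lemma isOpen_halfSpace : IsOpen halfSpace := isOpen_lt continuous_const (by fun_prop)

lemma norm_rest_sq (u : Lp ℂ 2 (volume : Measure Space)) :
    ‖rest u‖ ^ 2 = ∫ x in halfSpace, (u x).re ^ 2 := by
  rw [← real_inner_self_eq_norm_sq, L2.inner_def]
  refine integral_congr_ae ?_
  filter_upwards [coeFn_rest u] with x hx
  rw [hx]; simp [sq]

lemma norm_sq_eq_integral (u : Lp ℂ 2 (volume : Measure Space)) :
    ‖u‖ ^ 2 = ∫ x, ‖u x‖ ^ 2 := by
  have h := inner_self_eq_norm_sq (𝕜 := ℂ) u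
  rw [← h, L2.inner_def, ← integral_re]
  · refine integral_congr_ae (ae_of_all _ fun x => ?_)
    exact inner_self_eq_norm_sq (𝕜 := ℂ) (u x)
  · exact L2.integrable_inner u u

lemma integrable_norm_sq (u : Lp ℂ 2 (volume : Measure Space)) :
    Integrable fun x => ‖u x‖ ^ 2 :=
  (Lp.memLp u).integrable_norm_pow (by norm_num)

lemma norm_rest_le (u : Lp ℂ 2 (volume : Measure Space)) : ‖rest u‖ ≤ ‖u‖ := by
  rw [← sq_le_sq₀ (norm_nonneg _) (norm_nonneg _), norm_rest_sq, norm_sq_eq_integral]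
  refine (setIntegral_mono_on ?_ (integrable_norm_sq u).integrableOn measurableSet_halfSpace
    fun x _ => ?_).trans (setIntegral_le_integral (integrable_norm_sq u)
      (ae_of_all _ fun x => sq_nonneg _))
  · refine (integrable_norm_sq u).integrableOn.mono'
      ((Complex.continuous_re.comp_aestronglyMeasurable (Lp.aestronglyMeasurable u)).pow 2).restrict
      (ae_of_all _ fun x => ?_)
    rw [Real.norm_eq_abs, abs_of_nonneg (sq_nonneg _), ← sq_abs (u x).re]
    exact pow_le_pow_left₀ (abs_nonneg _) (Complex.abs_re_le_norm _) 2
  · rw [← sq_abs (u x).re]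
    exact pow_le_pow_left₀ (abs_nonneg _) (Complex.abs_re_le_norm _) 2

/-- The vector field with the single component `rest u` in position `c`. -/
noncomputable def emb (c : Fin 3) : Lp ℂ 2 (volume : Measure Space) →L[ℝ] L2Vec :=
  ((PiLp.continuousLinearEquiv 2 ℝ (fun _ : Fin 3 => L2)).symm :
      (Fin 3 → L2) →L[ℝ] L2Vec) ∘L
    ContinuousLinearMap.single ℝ (fun _ : Fin 3 => L2) c ∘L rest

lemma emb_apply (c : Fin 3) (u : Lp ℂ 2 (volume : Measure Space)) (i : Fin 3) :
    emb c u i = if i = c then rest u else 0 := by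
  simp [emb]

lemma norm_emb (c : Fin 3) (u : Lp ℂ 2 (volume : Measure Space)) : ‖emb c u‖ = ‖rest u‖ := by
  have : ‖emb c u‖ ^ 2 = ‖rest u‖ ^ 2 := by
    rw [PiLp.norm_sq_eq_of_L2]
    simp only [emb_apply]
    rw [Finset.sum_eq_single c] <;> simp +contextual
  exact (sq_eq_sq₀ (norm_nonneg _) (norm_nonneg _)).1 this

/-! ### Weak derivatives and traces of restricted Schwartz functions. -/

lemma IsTest.contDiff_partialDeriv {U : Set Space} {φ : Space → ℝ} (hφ : IsTest U φ) (i : Fin 3) :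
    ContDiff ℝ ∞ (partialDeriv i φ) :=
  (hφ.1.fderiv_right (m := ∞) (by simp)).clm_apply contDiff_const

lemma IsTest.partialDeriv {U : Set Space} {φ : Space → ℝ} (hφ : IsTest U φ) (i : Fin 3) :
    IsTest U (partialDeriv i φ) := by
  have hs : tsupport (VonKarman.partialDeriv i φ) ⊆ tsupport φ := by
    refine closure_minimal (fun x hx => ?_) (isClosed_tsupport φ)
    by_contra h
    have : fderiv ℝ φ x = 0 := by
      by_contra h'
      exact h (support_fderiv_subset ℝ h')
    exact hx (by simp [VonKarman.partialDeriv, this])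
  exact ⟨hφ.contDiff_partialDeriv i, hφ.2.1.of_isClosed_subset (isClosed_tsupport _) hs,
    hs.trans hφ.2.2⟩

lemma IsTest.eq_zero {U : Set Space} {φ : Space → ℝ} (hφ : IsTest U φ) {x : Space} (hx : x ∉ U) :
    φ x = 0 := image_eq_zero_of_notMem_tsupport fun h => hx (hφ.2.2 h)

lemma fderiv_re_lineDeriv (f : 𝓢(Space, ℂ)) (i : Fin 3) (x : Space) :
    partialDeriv i (fun y => (f y).re) x =
      ((∂_{(EuclideanSpace.single i (1 : ℝ) : Space)} f) x).re := by
  have h := (Complex.reCLM.hasFDerivAt (x := f x)).comp x (f.differentiableAt (x := x)).hasFDerivAt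
  rw [SchwartzMap.lineDerivOp_apply_eq_fderiv]
  have h' : HasFDerivAt (fun y => (f y).re) (Complex.reCLM.comp (fderiv ℝ f x)) x := h
  rw [partialDeriv, h'.fderiv]; rfl

/-- Integration by parts against a test function. -/
lemma integral_mul_partialDeriv (g φ : Space → ℝ) (hg : ContDiff ℝ ∞ g)
    (hφ : IsTest Set.univ φ) (i : Fin 3) :
    ∫ x, g x * partialDeriv i φ x = - ∫ x, partialDeriv i g x * φ x := by
  have hc : Continuous (partialDeriv i g) :=
    ((hg.fderiv_right (m := ∞) (by simp)).clm_apply contDiff_const).continuous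
  have hφ' := hφ.partialDeriv i
  exact integral_mul_fderiv_eq_neg_fderiv_mul_of_integrable
    ((hc.mul hφ.1.continuous).integrable_of_hasCompactSupport hφ.2.1.mul_left)
    ((hg.continuous.mul hφ'.1.continuous).integrable_of_hasCompactSupport hφ'.2.1.mul_left)
    ((hg.continuous.mul hφ.1.continuous).integrable_of_hasCompactSupport hφ.2.1.mul_left)
    (fun x _ => hg.differentiable (by simp) x) (fun x _ => hφ.1.differentiable (by simp) x)

lemma IsTest.mono {U V : Set Space} {φ : Space → ℝ} (hφ : IsTest U φ) (h : U ⊆ V) : IsTest V φ :=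
  ⟨hφ.1, hφ.2.1, hφ.2.2.trans h⟩

lemma contDiff_re (f : 𝓢(Space, ℂ)) : ContDiff ℝ ∞ fun x => (f x).re :=
  Complex.reCLM.contDiff.comp (f.smooth ⊤)

/-- The test function vanishes off the half-space, so both integrals extend to the whole space,
where integration by parts has no boundary term. -/
lemma hasWeakDeriv_rest (f : 𝓢(Space, ℂ)) (i : Fin 3) :
    HasWeakDeriv i (rest (f.toLp 2))
      (rest ((∂_{(EuclideanSpace.single i (1 : ℝ) : Space)} f).toLp 2)) := by
  intro φ hφ
  have h1 : ∫ x in halfSpace, rest (f.toLp 2) x * partialDeriv i φ x =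
      ∫ x, (f x).re * partialDeriv i φ x := by
    rw [← setIntegral_eq_integral_of_forall_compl_eq_zero (μ := volume) (s := halfSpace)
      (f := fun x => (f x).re * partialDeriv i φ x)
      fun x hx => by rw [(hφ.partialDeriv i).eq_zero hx, mul_zero]]
    refine integral_congr_ae ?_
    filter_upwards [coeFn_rest_toLp f] with x hx
    rw [hx]
  have h2 : ∫ x in halfSpace,
      rest ((∂_{(EuclideanSpace.single i (1 : ℝ) : Space)} f).toLp 2) x * φ x =
      ∫ x, partialDeriv i (fun y => (f y).re) x * φ x := by
    rw [← setIntegral_eq_integral_of_forall_compl_eq_zero (μ := volume) (s := halfSpace)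
      (f := fun x => partialDeriv i (fun y => (f y).re) x * φ x)
      fun x hx => by rw [hφ.eq_zero hx, mul_zero]]
    refine integral_congr_ae ?_
    filter_upwards [coeFn_rest_toLp (∂_{(EuclideanSpace.single i (1 : ℝ) : Space)} f)] with x hx
    rw [hx, fderiv_re_lineDeriv]
  rw [h1, h2]
  exact integral_mul_partialDeriv _ φ (contDiff_re f) (hφ.mono (Set.subset_univ _)) i

/-- The point with horizontal coordinates `y` and height `t`. -/
noncomputable def vline (y : Fin 2 → ℝ) (t : ℝ) : Space :=
  WithLp.toLp 2 (Fin.insertNth (α := fun _ => ℝ) 2 t y)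

lemma vline_eq (y : Fin 2 → ℝ) (t : ℝ) :
    vline y t = vline y 0 + t • EuclideanSpace.single (2 : Fin 3) (1 : ℝ) := by
  ext i
  fin_cases i
  · have : (0 : Fin 3) = (2 : Fin 3).succAbove 0 := by decide
    simp [vline]; rw [this, Fin.insertNth_apply_succAbove, Fin.insertNth_apply_succAbove]
  · have : (1 : Fin 3) = (2 : Fin 3).succAbove 1 := by decide
    simp [vline]; rw [this, Fin.insertNth_apply_succAbove, Fin.insertNth_apply_succAbove]
  · simp [vline]

lemma vline_two (y : Fin 2 → ℝ) (t : ℝ) : vline y t 2 = t := by simp [vline]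

/-- Fubini's theorem on the half-space. -/
lemma setIntegral_halfSpace_eq {G : Space → ℝ} (hG : Integrable G) :
    ∫ x in halfSpace, G x = ∫ y : Fin 2 → ℝ, ∫ t in Set.Ioi (0 : ℝ), G (vline y t) := by
  have mp : MeasurePreserving (fun p : ℝ × (Fin 2 → ℝ) => vline p.2 p.1) :=
    (PiLp.volume_preserving_toLp (Fin 3)).comp
      ((volume_preserving_piFinSuccAbove (fun _ : Fin 3 => ℝ) 2).symm)
  have me : MeasurableEmbedding (fun p : ℝ × (Fin 2 → ℝ) => vline p.2 p.1) :=
    ((MeasurableEquiv.piFinSuccAbove (fun _ : Fin 3 => ℝ) 2).symm.trans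
      (MeasurableEquiv.toLp 2 (Fin 3 → ℝ))).measurableEmbedding
  have hI := (hG.indicator measurableSet_halfSpace)
  rw [← integral_indicator measurableSet_halfSpace, ← mp.integral_comp me]
  rw [Measure.volume_eq_prod, integral_prod_symm]
  · refine integral_congr_ae (ae_of_all _ fun y => ?_)
    dsimp only
    rw [← integral_indicator measurableSet_Ioi]
    refine integral_congr_ae (ae_of_all _ fun t => ?_)
    simp [Set.indicator_apply, halfSpace, vline_two]
  · rw [← Measure.volume_eq_prod]
    exact (mp.integrable_comp_emb me).2 hI

/-- Fundamental theorem of calculus on each vertical half-line: the only boundary value is the one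
at height zero. -/
lemma setIntegral_partialDeriv_two_eq_zero {F : Space → ℝ} (hF : IsTest Set.univ F)
    (h0 : ∀ x : Space, x 2 = 0 → F x = 0) : ∫ x in halfSpace, partialDeriv 2 F x = 0 := by
  have hF' := hF.partialDeriv 2
  rw [setIntegral_halfSpace_eq (hF'.1.continuous.integrable_of_hasCompactSupport hF'.2.1)]
  refine integral_eq_zero_of_ae (ae_of_all _ fun y => ?_)
  have hd : ∀ t, HasDerivAt (fun t => F (vline y t)) (partialDeriv 2 F (vline y t)) t := by
    intro t
    have h1 : HasDerivAt (vline y) (EuclideanSpace.single (2 : Fin 3) (1 : ℝ)) t := by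
      rw [funext (vline_eq y)]
      simpa using ((hasDerivAt_id t).smul_const
        (EuclideanSpace.single (2 : Fin 3) (1 : ℝ))).const_add (vline y 0)
    exact ((hF.1.differentiable (by simp)) (vline y t)).hasFDerivAt.comp_hasDerivAt t h1
  have hc : Continuous (vline y) := by
    rw [funext (vline_eq y)]; fun_prop
  have hcd : ContDiff ℝ 1 (fun t => F (vline y t)) := by
    rw [funext (vline_eq y)]
    exact (hF.1.of_le (by simp)).comp (by fun_prop)
  have hcs : HasCompactSupport (fun t => F (vline y t)) := by
    have hce : Topology.IsClosedEmbedding (vline y) :=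
      Function.LeftInverse.isClosedEmbedding (f := fun x : Space => x 2)
        (vline_two y) (by fun_prop) hc
    exact hF.2.1.comp_isClosedEmbedding hce
  have := hcs.integral_Ioi_deriv_eq hcd 0
  rw [funext fun t => (hd t).deriv] at this
  simpa [h0 _ (vline_two y 0)] using this

lemma IsOdd.eq_zero {f : 𝓢(Space, ℂ)} (hf : IsOdd f) {x : Space} (hx : x 2 = 0) : f x = 0 := by
  have h : reflect x = x := by
    ext i
    rw [reflect_apply]
    split_ifs with hi
    · rw [hi, hx, neg_zero]
    · rfl
  have := hf x
  rw [h] at this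
  exact self_eq_neg.1 this

/-- By the product rule the integrand is the vertical derivative of `f φ`, which vanishes on the
plane fixed by the reflection. -/
lemma traceZero_rest {f : 𝓢(Space, ℂ)} (hf : IsOdd f) :
    TraceZero (rest (f.toLp 2))
      (rest ((∂_{(EuclideanSpace.single 2 (1 : ℝ) : Space)} f).toLp 2)) := by
  intro φ hφ
  have hF : IsTest Set.univ (fun x => (f x).re * φ x) :=
    ⟨(contDiff_re f).mul hφ.1, hφ.2.1.mul_left, Set.subset_univ _⟩
  rw [← setIntegral_partialDeriv_two_eq_zero hF fun x hx => by simp [hf.eq_zero hx]]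
  refine integral_congr_ae ?_
  filter_upwards [coeFn_rest_toLp f,
    coeFn_rest_toLp (∂_{(EuclideanSpace.single 2 (1 : ℝ) : Space)} f)] with x h1 h2
  rw [h1, h2, ← fderiv_re_lineDeriv, partialDeriv, partialDeriv, partialDeriv,
    fderiv_fun_mul ((contDiff_re f).differentiable (by simp) x) (hφ.1.differentiable (by simp) x)]
  simp; ring

lemma hasWeakDeriv_zero (i : Fin 3) : HasWeakDeriv i 0 0 := by
  intro φ _
  have h0 := Lp.coeFn_zero ℝ 2 halfVol
  have h1 : ∀ g : Space → ℝ, ∫ x in halfSpace, (0 : L2) x * g x = 0 := fun g =>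
    integral_eq_zero_of_ae (by
      filter_upwards [h0] with x hx; rw [hx, Pi.zero_apply, zero_mul])
  rw [h1, h1, neg_zero]

lemma traceZero_zero : TraceZero 0 0 := by
  intro φ _
  exact integral_eq_zero_of_ae (by
    filter_upwards [Lp.coeFn_zero ℝ 2 halfVol] with x hx
    rw [hx, Pi.zero_apply, zero_mul, zero_mul, add_zero])

/-- The Dirichlet components: `A (Id - L² Δ)⁻¹ f = f` for `f` odd. -/
lemma emb_bessel_mem_operatorGraph (L : ℝ) (κ : WithTop ℝ) {f : 𝓢(Space, ℂ)} (hf : IsOdd f)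
    {c : Fin 3} (hc : c ≠ 2) :
    (emb c ((bessel L 1 f).toLp 2), emb c (f.toLp 2)) ∈ operatorGraph (fun _ => L) κ := by
  set u := bessel L 1 f with hu
  have huo : IsOdd u := hf.bessel L 1
  set e : Fin 3 → Space := fun i => EuclideanSpace.single i (1 : ℝ)
  refine ⟨fun a i => if a = c then rest ((∂_{e i} u).toLp 2) else 0,
    fun a i j => if a = c then rest ((∂_{e j} (∂_{e i} u)).toLp 2) else 0, ?_, ?_, ?_, ?_, ?_, ?_,
    ?_⟩
  · intro a i
    simp only [emb_apply]
    split_ifs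
    exacts [hasWeakDeriv_rest u i, hasWeakDeriv_zero i]
  · intro a i j
    dsimp only
    split_ifs
    exacts [hasWeakDeriv_rest _ j, hasWeakDeriv_zero j]
  · simp only [emb_apply]
    split_ifs
    exacts [traceZero_rest huo, traceZero_zero]
  · simp only [emb_apply]
    split_ifs
    exacts [traceZero_rest huo, traceZero_zero]
  -- The third component of the field is zero because `c ≠ 2`, so the condition at `κ = ⊤`, like the
  -- Robin condition after it, holds trivially.
  · intro _
    simp only [emb_apply, if_neg hc.symm]
    exact traceZero_zero
  · intro k _
    simp only [emb_apply, if_neg hc.symm, smul_zero, add_zero]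
    exact traceZero_zero
  · intro a
    simp only [emb_apply]
    split_ifs
    · have h := bessel_one_sub_laplacian L f
      rw [← hu] at h
      have h2 := congrArg (fun g => rest (SchwartzMap.toLpCLM ℂ ℂ 2 volume g)) h
      simp only [map_sub, map_sum, map_smul, SchwartzMap.toLpCLM_apply] at h2
      rw [← h2]
      congr 1
      refine Finset.sum_congr rfl fun i _ => ?_
      rw [← map_smul]
      congr 1
      have : (L : ℂ) ^ 2 = ((L ^ 2 : ℝ) : ℂ) := by push_cast; rfl
      rw [this]
      rfl
    · simp

/-! ### Identification of the fractional power in an arbitrary spectral representation. -/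

lemma coeFn_sum_smul {Y : Type*} [MeasurableSpace Y] {ν : Measure Y} (a : ℕ → Lp ℝ 2 ν)
    (c : ℕ → ℝ) (s : Finset ℕ) :
    ⇑(∑ i ∈ s, c i • a i) =ᵐ[ν] fun y => ∑ i ∈ s, c i * a i y := by
  induction s using Finset.induction_on with
  | empty =>
    filter_upwards [Lp.coeFn_zero ℝ 2 ν] with y hy
    rw [Finset.sum_empty, Finset.sum_empty, hy]; rfl
  | insert j s hj ih =>
    rw [Finset.sum_insert hj]
    filter_upwards [ih, Lp.coeFn_add (c j • a j) (∑ i ∈ s, c i • a i),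
      Lp.coeFn_smul (c j) (a j)] with y h1 h2 h3
    rw [h2, Pi.add_apply, h1, h3, Pi.smul_apply, Finset.sum_insert hj, smul_eq_mul]

/-- If `aₙ = lam · aₙ₊₁` is a bounded sequence in `L²`, then `aₙ = lam⁻ⁿ a₀`, and `lam ≥ 1` on the
support of `a₀`. -/
lemma ae_eq_inv_pow_mul {Y : Type*} [MeasurableSpace Y] {ν : Measure Y} {lam : Y → ℝ}
    {a : ℕ → Lp ℝ 2 ν} (ha : ∀ n, ⇑(a n) =ᵐ[ν] fun y => lam y * a (n + 1) y)
    {C : ℝ} (hC : ∀ n, ‖a n‖ ≤ C) :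
    ∀ᵐ y ∂ν, (∀ n, a n y = (lam y)⁻¹ ^ n * a 0 y) ∧ (lam y = 0 → a 0 y = 0) ∧
      (a 0 y ≠ 0 → |(lam y)⁻¹| ≤ 1) := by
  -- Bounded `L²` norms force a finite lower limit of `|aₙ|` almost everywhere; this excludes the
  -- geometric growth that `|lam⁻¹| > 1` would cause.
  have hb := ae_bdd_liminf_atTop_of_eLpNorm_bdd (μ := ν) (p := 2) (by norm_num)
    (f := fun n => ⇑(a n)) (R := C.toNNReal) (fun n => (Lp.stronglyMeasurable _).measurable)
    fun n => by
      rw [← Lp.enorm_def, enorm_eq_nnnorm, ENNReal.coe_le_coe, ← NNReal.coe_le_coe]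
      exact (hC n).trans (Real.le_coe_toNNReal C)
  filter_upwards [ae_all_iff.2 ha, hb] with y h1 h2
  have h0 : lam y = 0 → ∀ n, a n y = 0 := fun h n => by rw [h1 n, h, zero_mul]
  have h3 : ∀ n, a n y = (lam y)⁻¹ ^ n * a 0 y := by
    by_cases hl : lam y = 0
    · intro n
      rw [h0 hl, h0 hl, mul_zero]
    · intro n
      induction n with
      | zero => simp
      | succ n ih =>
        rw [h1 n] at ih
        rw [pow_succ, mul_right_comm, ← ih]
        field_simp
  refine ⟨h3, fun h => h0 h 0, fun hne => ?_⟩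
  by_contra! hgt
  have ht : Tendsto (fun n => ‖a n y‖ₑ) atTop (𝓝 ⊤) := by
    have : Tendsto (fun n => ‖a n y‖) atTop atTop := by
      have he : (fun n => ‖a n y‖) = fun n => |(lam y)⁻¹| ^ n * |a 0 y| := by
        funext n
        rw [h3 n, norm_mul, norm_pow, Real.norm_eq_abs, Real.norm_eq_abs]
      rw [he]
      exact (tendsto_pow_atTop_atTop_of_one_lt hgt).atTop_mul_const (abs_pos.2 hne)
    have h4 := ENNReal.tendsto_ofReal_atTop.comp this
    exact h4.congr fun n => ofReal_norm _
  exact h2.ne ht.liminf_eq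

/-- A polynomial functional calculus determines the fractional powers. -/
lemma ae_eq_rpow_mul {Y : Type*} [MeasurableSpace Y] {ν : Measure Y} {lam : Y → ℝ}
    (hlam : ∀ᵐ y ∂ν, 0 ≤ lam y) {a : ℕ → Lp ℝ 2 ν}
    (ha : ∀ n, ⇑(a n) =ᵐ[ν] fun y => lam y * a (n + 1) y) {C : ℝ} (hC : ∀ n, ‖a n‖ ≤ C)
    {α : ℝ} (hα : 0 < α) {b : Lp ℝ 2 ν} {M : ℝ}
    (hb : ∀ (p : Polynomial ℝ) (ε : ℝ), (∀ x ∈ Set.Icc (0 : ℝ) 1, |p.eval x - x ^ α| < ε) →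
      ‖∑ i ∈ Finset.range (p.natDegree + 1), p.coeff i • a i - b‖ ≤ ε * M) :
    ⇑(a 0) =ᵐ[ν] fun y => lam y ^ α * b y := by
  -- Weierstrass approximation of `x ^ α`; the interval `[0, 1]` suffices because `lam⁻¹` lies in it
  -- wherever `a 0` is nonzero.
  have hex : ∀ n : ℕ, ∃ p : Polynomial ℝ, ∀ x ∈ Set.Icc (0 : ℝ) 1,
      |p.eval x - x ^ α| < 1 / ((n : ℝ) + 1) := fun n =>
    exists_polynomial_near_of_continuousOn 0 1 (fun x => x ^ α)
      (Real.continuous_rpow_const hα.le).continuousOn _ (by positivity)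
  choose p hp using hex
  set F : ℕ → Lp ℝ 2 ν := fun n =>
    ∑ i ∈ Finset.range ((p n).natDegree + 1), (p n).coeff i • a i with hF
  have hlim : Tendsto F atTop (𝓝 b) := by
    rw [tendsto_iff_norm_sub_tendsto_zero]
    refine squeeze_zero (fun _ => norm_nonneg _) (fun n => hb (p n) _ (hp n)) ?_
    simpa using tendsto_one_div_add_atTop_nhds_zero_nat.mul_const M
  -- Convergence in `L²` gives almost everywhere convergence along a subsequence, so `b` can be
  -- identified pointwise.
  obtain ⟨ns, hns, hae⟩ := (tendstoInMeasure_of_tendsto_Lp hlim).exists_seq_tendsto_ae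
  have hsum := ae_all_iff.2 fun n =>
    coeFn_sum_smul a (p n).coeff (Finset.range ((p n).natDegree + 1))
  filter_upwards [hlam, ae_eq_inv_pow_mul ha hC, hae, hsum] with y hl ⟨h1, h2, h3⟩ h4 h5
  have h6 : ∀ n, F n y = (p n).eval (lam y)⁻¹ * a 0 y := by
    intro n
    rw [hF]; dsimp only
    rw [h5 n, Polynomial.eval_eq_sum_range, Finset.sum_mul]
    refine Finset.sum_congr rfl fun i _ => ?_
    rw [h1 i, mul_assoc]
  have h7 : b y = (lam y)⁻¹ ^ α * a 0 y := by
    by_cases h0 : a 0 y = 0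
    · rw [h0, mul_zero]
      refine tendsto_nhds_unique h4 ?_
      simp [h6, h0]
    · refine tendsto_nhds_unique h4 ?_
      simp only [h6]
      refine Tendsto.mul_const _ ?_
      rw [tendsto_iff_dist_tendsto_zero]
      refine squeeze_zero (fun _ => dist_nonneg)
        (fun n => (hp (ns n) _ ⟨inv_nonneg.2 hl, (le_abs_self _).trans (h3 h0)⟩).le) ?_
      exact tendsto_one_div_add_atTop_nhds_zero_nat.comp hns.tendsto_atTop
  rw [h7]
  rcases hl.eq_or_lt with h | h
  · rw [h2 h.symm]; simp
  · rw [← mul_assoc, ← Real.mul_rpow hl (inv_nonneg.2 hl), mul_inv_cancel₀ h.ne',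
      Real.one_rpow, one_mul]

lemma bessel_bessel (L s t : ℝ) (f : 𝓢(Space, ℂ)) :
    bessel L s (bessel L t f) = bessel L (s + t) f := by
  refine schwartz_ext_fourier fun k => ?_
  rw [fourier_bessel_apply, fourier_bessel_apply, fourier_bessel_apply, neg_add,
    Real.rpow_add (symb_pos L k)]
  push_cast; ring

lemma bessel_zero (L : ℝ) (f : 𝓢(Space, ℂ)) : bessel L 0 f = f := by
  refine schwartz_ext_fourier fun k => ?_
  rw [fourier_bessel_apply]; simp

/-- Comparison of `L²` norms on the Fourier side. -/
lemma norm_toLp_le_of_fourier {f g : 𝓢(Space, ℂ)} {C : ℝ}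
    (h : ∀ k, ‖(𝓕 g) k‖ ≤ C * ‖(𝓕 f) k‖) :
    ‖g.toLp 2 (volume : Measure Space)‖ ≤ C * ‖f.toLp 2 (volume : Measure Space)‖ := by
  rw [← SchwartzMap.norm_fourier_toL2_eq f, ← SchwartzMap.norm_fourier_toL2_eq g]
  refine Lp.norm_le_mul_norm_of_ae_le_mul ?_
  filter_upwards [(𝓕 f).coeFn_toLp 2 volume, (𝓕 g).coeFn_toLp 2 volume] with k h1 h2
  rw [h1, h2]; exact h k

lemma norm_emb_le (c : Fin 3) (u : Lp ℂ 2 (volume : Measure Space)) : ‖emb c u‖ ≤ ‖u‖ :=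
  (norm_emb c u).le.trans (norm_rest_le u)

/-- The fractional power of `A` on the Dirichlet components acts on odd functions by the
Fourier multiplier. -/
lemma emb_bessel_mem_powGraph {L : ℝ} {κ : WithTop ℝ}
    (S : SpectralRep (operatorGraph (fun _ => L) κ)) {f : 𝓢(Space, ℂ)} (hf : IsOdd f)
    {c : Fin 3} (hc : c ≠ 2) {α : ℝ} (hα : 0 < α) :
    (emb c ((bessel L α f).toLp 2), emb c (f.toLp 2)) ∈ S.powGraph α := by
  let _ := S.measY
  set V : 𝓢(Space, ℂ) →ₗ[ℝ] Lp ℝ 2 S.ν :=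
    (S.U.toLinearEquiv : L2Vec →ₗ[ℝ] Lp ℝ 2 S.ν) ∘ₗ (emb c : _ →ₗ[ℝ] L2Vec) ∘ₗ
      ((SchwartzMap.toLpCLM ℝ ℂ 2 volume :
        𝓢(Space, ℂ) →L[ℝ] Lp ℂ 2 (volume : Measure Space)) :
        𝓢(Space, ℂ) →ₗ[ℝ] Lp ℂ 2 (volume : Measure Space)) with hV
  have hVapp : ∀ g : 𝓢(Space, ℂ), V g = S.U (emb c (g.toLp 2)) := fun g => rfl
  have hVle : ∀ g : 𝓢(Space, ℂ), ‖V g‖ ≤ ‖g.toLp 2 (volume : Measure Space)‖ := fun g => by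
    rw [hVapp, S.U.norm_map]; exact norm_emb_le c _
  have hinv : ∀ k, (symb L k)⁻¹ ∈ Set.Icc (0 : ℝ) 1 := fun k =>
    ⟨inv_nonneg.2 (symb_pos L k).le, inv_le_one_of_one_le₀ (one_le_symb L k)⟩
  -- The sequence is `A⁻ⁿ f`. Since `(symb L k)⁻¹` lies in `[0, 1]`, Plancherel turns a uniform
  -- polynomial approximation of `x ^ α` there into the required `L²` estimate.
  have key := ae_eq_rpow_mul (lam := S.lam) S.lam_nonneg (a := fun n => V (bessel L n f))
    (C := 1 * ‖f.toLp 2 (volume : Measure Space)‖) (fun n => ?_) (fun n => ?_) hα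
    (b := V (bessel L α f)) (M := ‖f.toLp 2 (volume : Measure Space)‖) fun p ε hp => ?_
  · simpa [SpectralRep.powGraph, hVapp, bessel_zero] using key
  · have := emb_bessel_mem_operatorGraph L κ (hf.bessel L n) hc
    rw [bessel_bessel] at this
    have h := (S.mem_graph_iff _ _).1 this
    have e : bessel L ((n + 1 : ℕ) : ℝ) f = bessel L (1 + n) f := by
      congr 2; push_cast; ring
    simp only [hVapp, e]
    exact h
  · refine (hVle _).trans (norm_toLp_le_of_fourier fun k => ?_)
    rw [fourier_bessel_apply, norm_mul]
    refine mul_le_mul_of_nonneg_right ?_ (norm_nonneg _)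
    rw [Complex.norm_real, Real.norm_eq_abs, abs_of_pos (Real.rpow_pos_of_pos (symb_pos L k) _)]
    exact Real.rpow_le_one_of_one_le_of_nonpos (one_le_symb L k) (by simp)
  · simp only [← map_smul, ← map_sum, ← map_sub]
    refine (hVle _).trans (norm_toLp_le_of_fourier fun k => ?_)
    have e : (𝓕 (∑ i ∈ Finset.range (p.natDegree + 1), p.coeff i • bessel L i f -
        bessel L α f)) k =
        ((p.eval (symb L k)⁻¹ - (symb L k)⁻¹ ^ α : ℝ) : ℂ) * (𝓕 f) k := by
      rw [sub_eq_add_neg, FourierTransform.fourier_add, FourierTransform.fourier_neg,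
        FourierTransform.fourier_sum, add_apply, neg_apply, fourier_bessel_apply,
        sum_apply, Polynomial.eval_eq_sum_range]
      simp only [FourierTransform.fourier_smul, smul_apply, fourier_bessel_apply]
      push_cast
      rw [sub_mul, Finset.sum_mul, sub_eq_add_neg]
      congr 1
      · refine Finset.sum_congr rfl fun i _ => ?_
        rw [Complex.real_smul, Real.rpow_neg (symb_pos L k).le, Real.rpow_natCast]
        push_cast; ring
      · rw [Real.rpow_neg (symb_pos L k).le, Real.inv_rpow (symb_pos L k).le]
    rw [e, norm_mul, Complex.norm_real, Real.norm_eq_abs]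
    exact mul_le_mul_of_nonneg_right (hp _ (hinv k)).le (norm_nonneg _)

/-! ### Point-source kernels and their mirror images on the Fourier side. -/

/-- The symbol grows like `‖k‖²`, and `‖k‖ ^ (-2r)` is integrable at infinity in dimension three
when `2r > 3`. -/
lemma integrable_symb_rpow {L r : ℝ} (hL : 0 < L) (hr : 3 / 2 < r) :
    Integrable fun k : Space => symb L k ^ (-r) := by
  have h : Integrable fun k : Space => (1 + ‖k‖ ^ 2) ^ (-(2 * r) / 2) :=
    integrable_rpow_neg_one_add_norm_sq (by simp; linarith)
  have h2 := h.comp_smul (R := 2 * Real.pi * L) (by positivity)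
  simpa [symb, neg_div] using h2

/-- The symbol of `∂ⱼ (Id - L² Δ)^{-s}`. -/
noncomputable def derivSymb (L s : ℝ) (j : Fin 3) (k : Space) : ℂ :=
  ((symb L k ^ (-s) : ℝ) : ℂ) * (2 * Real.pi * Complex.I * (k j : ℂ))

lemma continuous_derivSymb (L s : ℝ) (j : Fin 3) : Continuous (derivSymb L s j) := by
  unfold derivSymb
  have := continuous_symb_rpow L (-s)
  fun_prop

lemma norm_derivSymb_sq (L s : ℝ) (j : Fin 3) (k : Space) :
    ‖derivSymb L s j k‖ ^ 2 = symb L k ^ (-(2 * s)) * ((2 * Real.pi) ^ 2 * k j ^ 2) := by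
  rw [derivSymb, norm_mul, mul_pow, Complex.norm_real, Real.norm_eq_abs, sq_abs,
    ← Real.rpow_mul_natCast (symb_pos L k).le]
  congr 1
  · congr 1; push_cast; ring
  · simp [mul_pow, sq_abs]

lemma norm_derivSymb_sq_le {L : ℝ} (hL : 0 < L) (s : ℝ) (j : Fin 3) (k : Space) :
    ‖derivSymb L s j k‖ ^ 2 ≤ (L ^ 2)⁻¹ * symb L k ^ (-(2 * s - 1)) := by
  rw [norm_derivSymb_sq, show -(2 * s - 1) = -(2 * s) + 1 by ring, Real.rpow_add (symb_pos L k),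
    Real.rpow_one, mul_left_comm (L ^ 2)⁻¹]
  refine mul_le_mul_of_nonneg_left ?_ (Real.rpow_nonneg (symb_pos L k).le _)
  have h : k j ^ 2 ≤ ‖k‖ ^ 2 := by
    rw [← sq_abs (k j)]
    exact pow_le_pow_left₀ (abs_nonneg _) (PiLp.norm_apply_le k j) 2
  rw [symb_eq, le_inv_mul_iff₀ (by positivity)]
  have h2 : 0 ≤ (2 * Real.pi * L) ^ 2 * (‖k‖ ^ 2 - k j ^ 2) :=
    mul_nonneg (sq_nonneg _) (sub_nonneg.2 h)
  nlinarith

/-- The factor `k_j²` costs one power of the symbol, so square-integrability needs `2s - 1 > 3/2`.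
This is the threshold `5/4`, which `17/12` exceeds; it makes point values of `w` meaningful. -/
lemma memLp_derivSymb {L s : ℝ} (hL : 0 < L) (hs : 5 / 4 < s) (j : Fin 3) :
    MemLp (derivSymb L s j) 2 (volume : Measure Space) := by
  rw [memLp_two_iff_integrable_sq_norm (continuous_derivSymb L s j).aestronglyMeasurable]
  refine ((integrable_symb_rpow hL (r := 2 * s - 1) (by linarith)).const_mul (L ^ 2)⁻¹).mono'
    ((continuous_derivSymb L s j).norm.pow 2).aestronglyMeasurable (ae_of_all _ fun k => ?_)
  rw [Real.norm_eq_abs, abs_of_nonneg (sq_nonneg _)]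
  exact norm_derivSymb_sq_le hL s j k

/-- The character `k ↦ exp (-2πi ⟨x, k⟩)`. -/
noncomputable def char (x k : Space) : ℂ :=
  Complex.exp ((-2 * Real.pi * ⟪x, k⟫_ℝ : ℝ) * Complex.I)

lemma norm_char (x k : Space) : ‖char x k‖ = 1 := Complex.norm_exp_ofReal_mul_I _

lemma continuous_char : Continuous fun p : Space × Space => char p.1 p.2 := by
  unfold char; fun_prop

lemma continuous_char_left (k : Space) : Continuous fun x => char x k := by
  unfold char; fun_prop

lemma continuous_char_right (x : Space) : Continuous fun k => char x k := by
  unfold char; fun_prop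

lemma fourier_eq_integral_char (f : 𝓢(Space, ℂ)) (k : Space) :
    (𝓕 f) k = ∫ x, f x * char x k := by
  rw [SchwartzMap.fourier_coe, Real.fourier_eq']
  simp only [char, smul_eq_mul, mul_comm]

lemma memLp_derivSymb_mul_char {L s : ℝ} (hL : 0 < L) (hs : 5 / 4 < s) (j : Fin 3) (x : Space) :
    MemLp (fun k => derivSymb L s j k * char x k) 2 (volume : Measure Space) :=
  (memLp_derivSymb hL hs j).of_le
    ((continuous_derivSymb L s j).mul (continuous_char_right x)).aestronglyMeasurable
    (ae_of_all _ fun k => by rw [norm_mul, norm_char, mul_one])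

/-- The Fourier transform of `∂ⱼ (Id - L² Δ)^{-s} δ_x`. -/
noncomputable def pointHat {L s : ℝ} (hL : 0 < L) (hs : 5 / 4 < s) (j : Fin 3) (x : Space) :
    Lp ℂ 2 (volume : Measure Space) :=
  (memLp_derivSymb_mul_char hL hs j x).toLp _

section

variable {L s : ℝ} (hL : 0 < L) (hs : 5 / 4 < s) (j : Fin 3)

lemma coeFn_pointHat (x : Space) :
    pointHat hL hs j x =ᵐ[volume] fun k => derivSymb L s j k * char x k :=
  MemLp.coeFn_toLp _

lemma norm_pointHat (x : Space) :
    ‖pointHat hL hs j x‖ = ‖(memLp_derivSymb hL hs j).toLp _‖ := by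
  rw [pointHat, Lp.norm_toLp, Lp.norm_toLp]
  congr 1
  exact eLpNorm_congr_norm_ae (ae_of_all _ fun k => by rw [norm_mul, norm_char, mul_one])

lemma integrable_norm_derivSymb_sq (hL : 0 < L) (hs : 5 / 4 < s) (j : Fin 3) :
    Integrable fun k => ‖derivSymb L s j k‖ ^ 2 :=
  (memLp_derivSymb hL hs j).integrable_norm_pow (by norm_num)

/-- Dominated convergence: characters have modulus one, so their squared difference is at most `4`.
-/
lemma continuous_pointHat : Continuous (pointHat hL hs j) := by
  rw [continuous_iff_continuousAt]
  intro x
  rw [ContinuousAt, tendsto_iff_norm_sub_tendsto_zero]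
  have h1 : ∀ y, ‖pointHat hL hs j y - pointHat hL hs j x‖ ^ 2 =
      ∫ k, ‖derivSymb L s j k‖ ^ 2 * ‖char y k - char x k‖ ^ 2 := by
    intro y
    rw [norm_sq_eq_integral]
    refine integral_congr_ae ?_
    filter_upwards [Lp.coeFn_sub (pointHat hL hs j y) (pointHat hL hs j x),
      coeFn_pointHat hL hs j x, coeFn_pointHat hL hs j y] with k e1 e2 e3
    rw [e1, Pi.sub_apply, e2, e3, ← mul_sub, norm_mul, mul_pow]
  have h2 : Tendsto (fun y => ∫ k, ‖derivSymb L s j k‖ ^ 2 * ‖char y k - char x k‖ ^ 2) (𝓝 x)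
      (𝓝 (∫ _ : Space, (0 : ℝ))) := by
    refine tendsto_integral_filter_of_dominated_convergence
      (fun k => ‖derivSymb L s j k‖ ^ 2 * 4) (Eventually.of_forall fun y => ?_)
      (Eventually.of_forall fun y => ae_of_all _ fun k => ?_)
      ((integrable_norm_derivSymb_sq hL hs j).mul_const _) (ae_of_all _ fun k => ?_)
    · exact (((continuous_derivSymb L s j).norm.pow 2).mul (((continuous_char_right y).sub
        (continuous_char_right x)).norm.pow 2)).aestronglyMeasurable
    · rw [Real.norm_eq_abs, abs_of_nonneg (by positivity)]
      refine mul_le_mul_of_nonneg_left ?_ (sq_nonneg _)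
      have := norm_sub_le (char y k) (char x k)
      rw [norm_char, norm_char] at this
      nlinarith [norm_nonneg (char y k - char x k)]
    · have : Tendsto (fun y => ‖derivSymb L s j k‖ ^ 2 * ‖char y k - char x k‖ ^ 2) (𝓝 x)
          (𝓝 (‖derivSymb L s j k‖ ^ 2 * ‖char x k - char x k‖ ^ 2)) :=
        ((((continuous_char_left k).tendsto x).sub_const _).norm.pow 2).const_mul _
      simpa using this
  simp only [← h1, integral_zero] at h2
  have := h2.sqrt
  simpa [Real.sqrt_sq] using this

lemma integrable_smul_pointHat (φ : 𝓢(Space, ℂ)) :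
    Integrable fun x => φ x • pointHat hL hs j x := by
  refine (φ.integrable.norm.mul_const ‖(memLp_derivSymb hL hs j).toLp _‖).mono'
    (φ.continuous.smul (continuous_pointHat hL hs j)).aestronglyMeasurable (ae_of_all _ fun x => ?_)
  rw [norm_smul, norm_pointHat]

/-- Superposition of point sources. -/
lemma integral_smul_pointHat (φ : 𝓢(Space, ℂ)) :
    ∫ x, φ x • pointHat hL hs j x =
      (𝓕 (bessel L s (∂_{(EuclideanSpace.single j (1 : ℝ) : Space)} φ))).toLp 2 volume := by
  -- The Bochner integral is identified weakly: pair with an arbitrary `h`, exchange the `x` and `k`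
  -- integrals, and recognise the `x` integral as `𝓕 φ`.
  refine ext_inner_left ℂ fun h => ?_
  rw [← integral_inner (integrable_smul_pointHat hL hs j φ)]
  set F : Space → Space → ℂ := fun x k => (φ x * (derivSymb L s j k * char x k)) * conj (h k)
    with hF
  have h1 : ∀ x, ⟪h, φ x • pointHat hL hs j x⟫_ℂ = ∫ k, F x k := by
    intro x
    rw [L2.inner_def]
    refine integral_congr_ae ?_
    filter_upwards [Lp.coeFn_smul (φ x) (pointHat hL hs j x), coeFn_pointHat hL hs j x]
      with k e1 e2
    rw [e1, Pi.smul_apply, e2, RCLike.inner_apply, smul_eq_mul]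
  have hint : Integrable (Function.uncurry F) (volume.prod volume) := by
    have hb : Integrable fun k => ‖derivSymb L s j k‖ * ‖h k‖ :=
      (memLp_derivSymb hL hs j).norm.integrable_mul (Lp.memLp h).norm
    refine (φ.integrable.norm.mul_prod hb).mono' ?_ (ae_of_all _ fun p => ?_)
    · have hc : Continuous fun p : Space × Space =>
          φ p.1 * (derivSymb L s j p.2 * char p.1 p.2) :=
        (φ.continuous.comp continuous_fst).mul
          (((continuous_derivSymb L s j).comp continuous_snd).mul continuous_char)
      exact hc.aestronglyMeasurable.mul
        (Complex.continuous_conj.comp_aestronglyMeasurable (Lp.aestronglyMeasurable h).comp_snd)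
    · simp only [Function.uncurry, hF, norm_mul, norm_char, mul_one, RCLike.norm_conj]
      rw [mul_assoc]
  simp_rw [h1]
  rw [integral_integral_swap hint, L2.inner_def]
  refine integral_congr_ae ?_
  filter_upwards [(𝓕 (bessel L s (∂_{(EuclideanSpace.single j (1 : ℝ) : Space)} φ))).coeFn_toLp 2
    volume] with k e1
  rw [e1, RCLike.inner_apply, fourier_bessel_apply, fourier_lineDeriv_apply,
    fourier_eq_integral_char, hF]
  dsimp only
  rw [integral_mul_const]
  congr 1
  rw [← mul_assoc, ← integral_const_mul]
  refine integral_congr_ae (ae_of_all _ fun x => ?_)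
  simp only [derivSymb]; ring

lemma measurePreserving_reflect : MeasurePreserving reflect (volume : Measure Space) volume :=
  reflect.measurePreserving

/-- The Fourier transform of the odd extension of the kernel of `∂ⱼ A^{-s}` at `x`. -/
noncomputable def imageHat (x : Space) : Lp ℂ 2 (volume : Measure Space) :=
  pointHat hL hs j x - pointHat hL hs j (reflect x)

lemma continuous_imageHat : Continuous (imageHat hL hs j) :=
  (continuous_pointHat hL hs j).sub ((continuous_pointHat hL hs j).comp reflect.continuous)

lemma integrable_smul_imageHat (φ : 𝓢(Space, ℂ)) :
    Integrable fun x => φ x • imageHat hL hs j x := by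
  have h := (measurePreserving_reflect.integrable_comp_emb
    reflect.toHomeomorph.measurableEmbedding).2 (integrable_smul_pointHat hL hs j (reflectS φ))
  refine ((integrable_smul_pointHat hL hs j φ).sub h).congr (ae_of_all _ fun x => ?_)
  simp [imageHat, smul_sub, reflect_reflect]

/-- A change of variables moves the reflection onto `φ`. A horizontal derivative commutes with it,
so the two terms combine into the odd extension of `∂ⱼ φ`; a vertical derivative would change sign.
-/
lemma integral_smul_imageHat (hj : j ≠ 2) (φ : 𝓢(Space, ℂ)) :
    ∫ x, φ x • imageHat hL hs j x =
      (𝓕 (bessel L s (oddExt (∂_{(EuclideanSpace.single j (1 : ℝ) : Space)} φ)))).toLp 2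
        volume := by
  have h := integral_smul_pointHat hL hs j (reflectS φ)
  rw [← measurePreserving_reflect.integral_comp
    reflect.toHomeomorph.measurableEmbedding] at h
  have h' := (measurePreserving_reflect.integrable_comp_emb
    reflect.toHomeomorph.measurableEmbedding).2 (integrable_smul_pointHat hL hs j (reflectS φ))
  simp only [Function.comp_def, reflectS_apply, reflect_reflect] at h h'
  simp only [imageHat, smul_sub]
  rw [integral_sub (integrable_smul_pointHat hL hs j φ) h', h, integral_smul_pointHat]
  simp only [← SchwartzMap.toLpCLM_apply (𝕜 := ℂ)]
  rw [← map_sub]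
  congr 1
  ext k
  simp only [sub_apply, fourier_bessel_apply, fourier_oddExt, fourier_lineDeriv_apply,
    fourier_reflectS, reflect_apply, if_neg hj]
  ring

end

/-! ### Symmetries of the `L²` Fourier transform and the energy of the image kernel. -/

/-- Continuous maps on `L²` that agree on Schwartz functions are equal. -/
lemma L2_map_ext {A B : Lp ℂ 2 (volume : Measure Space) → Lp ℂ 2 (volume : Measure Space)}
    (hA : Continuous A) (hB : Continuous B) (h : ∀ f : 𝓢(Space, ℂ), A (f.toLp 2) = B (f.toLp 2))
    (u : Lp ℂ 2 (volume : Measure Space)) : A u = B u :=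
  congrFun ((SchwartzMap.denseRange_toLpCLM (E := Space) (F := ℂ) (p := 2)
    (μ := volume) (by norm_num)).equalizer hA hB (funext h)) u

/-- Composition with a linear isometry on `L²`. -/
noncomputable def compIso (A : Space ≃ₗᵢ[ℝ] Space) :
    Lp ℂ 2 (volume : Measure Space) →ₗᵢ[ℂ] Lp ℂ 2 (volume : Measure Space) :=
  Lp.compMeasurePreservingₗᵢ ℂ A A.measurePreserving

lemma coeFn_compIso (A : Space ≃ₗᵢ[ℝ] Space) (u : Lp ℂ 2 (volume : Measure Space)) :
    compIso A u =ᵐ[volume] fun x => u (A x) :=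
  Lp.coeFn_compMeasurePreserving u A.measurePreserving

lemma compIso_toLp (A : Space ≃ₗᵢ[ℝ] Space) (f : 𝓢(Space, ℂ)) :
    compIso A (f.toLp 2) =
      (SchwartzMap.compCLMOfContinuousLinearEquiv ℂ A.toContinuousLinearEquiv f).toLp 2 := by
  refine Lp.ext ?_
  filter_upwards [coeFn_compIso A (f.toLp 2),
    A.measurePreserving.quasiMeasurePreserving.ae (f.coeFn_toLp 2 volume),
    (SchwartzMap.compCLMOfContinuousLinearEquiv ℂ A.toContinuousLinearEquiv f).coeFn_toLp 2 volume]
    with x h1 h2 h3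
  rw [h1, h2, h3]; rfl

/-- Complex conjugation on `L²`. -/
noncomputable def conjL2 : Lp ℂ 2 (volume : Measure Space) →L[ℝ] Lp ℂ 2 (volume : Measure Space) :=
  (Complex.conjCLE : ℂ →L[ℝ] ℂ).compLpL 2 volume

lemma coeFn_conjL2 (u : Lp ℂ 2 (volume : Measure Space)) :
    conjL2 u =ᵐ[volume] fun x => conj (u x) :=
  (Complex.conjCLE : ℂ →L[ℝ] ℂ).coeFn_compLpL u

/-- Complex conjugation on Schwartz functions. -/
noncomputable def conjS : 𝓢(Space, ℂ) →L[ℝ] 𝓢(Space, ℂ) :=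
  SchwartzMap.postcompCLM (Complex.conjCLE : ℂ →L[ℝ] ℂ)

lemma conjL2_toLp (f : 𝓢(Space, ℂ)) : conjL2 (f.toLp 2) = (conjS f).toLp 2 := by
  refine Lp.ext ?_
  filter_upwards [coeFn_conjL2 (f.toLp 2), f.coeFn_toLp 2 volume, (conjS f).coeFn_toLp 2 volume]
    with x h1 h2 h3
  rw [h1, h2, h3]; rfl

lemma fourierInv_compIso (A : Space ≃ₗᵢ[ℝ] Space) (u : Lp ℂ 2 (volume : Measure Space)) :
    𝓕⁻ (compIso A u) = compIso A (𝓕⁻ u) := by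
  have hF : Continuous fun u : Lp ℂ 2 (volume : Measure Space) => 𝓕⁻ u :=
    FourierTransform.continuous_fourierInv
  refine L2_map_ext (A := fun u => 𝓕⁻ (compIso A u)) (B := fun u => compIso A (𝓕⁻ u))
    (hF.comp (compIso A).continuous) ((compIso A).continuous.comp hF) (fun f => ?_) u
  rw [compIso_toLp, SchwartzMap.toLp_fourierInv_eq, SchwartzMap.toLp_fourierInv_eq, compIso_toLp]
  congr 1
  ext x
  rw [SchwartzMap.fourierInv_coe]
  change _ = (𝓕⁻ f) (A x)
  rw [SchwartzMap.fourierInv_coe]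
  exact Real.fourierInv_comp_linearIsometry A f x

lemma fourier_compIso_neg (u : Lp ℂ 2 (volume : Measure Space)) :
    𝓕 (compIso (LinearIsometryEquiv.neg ℝ) u) = 𝓕⁻ u := by
  refine L2_map_ext (A := fun u => 𝓕 (compIso (LinearIsometryEquiv.neg ℝ) u)) (B := fun u => 𝓕⁻ u)
    (FourierTransform.continuous_fourier.comp (compIso _).continuous)
    FourierTransform.continuous_fourierInv (fun f => ?_) u
  rw [compIso_toLp, SchwartzMap.toLp_fourierInv_eq, SchwartzMap.toLp_fourier_eq,
    SchwartzMap.fourierInv_apply_eq]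
  congr 1
  ext x
  exact Real.fourier_comp_linearIsometry (LinearIsometryEquiv.neg ℝ) f x

lemma fourier_conjL2 (u : Lp ℂ 2 (volume : Measure Space)) :
    𝓕 (conjL2 u) = conjL2 (𝓕⁻ u) := by
  have hF : Continuous fun u : Lp ℂ 2 (volume : Measure Space) => 𝓕⁻ u :=
    FourierTransform.continuous_fourierInv
  refine L2_map_ext (A := fun u => 𝓕 (conjL2 u)) (B := fun u => conjL2 (𝓕⁻ u))
    (FourierTransform.continuous_fourier.comp conjL2.continuous)
    (conjL2.continuous.comp hF) (fun f => ?_) u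
  rw [conjL2_toLp, SchwartzMap.toLp_fourierInv_eq, SchwartzMap.toLp_fourier_eq, conjL2_toLp]
  congr 1
  ext x
  change _ = conj ((𝓕⁻ f) x)
  rw [SchwartzMap.fourierInv_coe, SchwartzMap.fourier_coe, Real.fourier_eq', Real.fourierInv_eq',
    ← integral_conj]
  refine integral_congr_ae (ae_of_all _ fun v => ?_)
  simp only [smul_eq_mul, map_mul, ← Complex.exp_conj, Complex.conj_ofReal, Complex.conj_I]
  change _ * conj (f v) = _
  congr 2
  push_cast; ring

lemma volume_boundary : (volume : Measure Space) {x | x 2 = 0} = 0 := by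
  have h := Measure.addHaar_submodule (volume : Measure Space)
    (LinearMap.ker (EuclideanSpace.proj 2 : Space →L[ℝ] ℝ).toLinearMap) (by
      intro h
      have : EuclideanSpace.single (2 : Fin 3) (1 : ℝ) ∈ (⊤ : Submodule ℝ Space) := trivial
      rw [← h] at this
      simp at this)
  exact h

/-- Real odd functions have half of their energy in the half-space. -/
lemma norm_rest_sq_of_odd {u : Lp ℂ 2 (volume : Measure Space)} (hr : conjL2 u = u)
    (ho : compIso reflect u = -u) : ‖rest u‖ ^ 2 = ‖u‖ ^ 2 / 2 := by
  have h1 : ∫ x in halfSpace, (u x).re ^ 2 = ∫ x in halfSpace, ‖u x‖ ^ 2 := by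
    refine integral_congr_ae (ae_restrict_of_ae ?_)
    have h := coeFn_conjL2 u
    rw [hr] at h
    filter_upwards [h] with x hx
    rw [Complex.sq_norm, Complex.normSq_apply, Complex.conj_eq_iff_im.1 hx.symm]
    ring
  -- Up to the null boundary plane the complement is the mirror image of the half-space, and `‖u‖`
  -- is invariant under the reflection.
  have h2 : ∫ x in halfSpaceᶜ, ‖u x‖ ^ 2 = ∫ x in halfSpace, ‖u x‖ ^ 2 := by
    have he : (halfSpaceᶜ : Set Space) =ᵐ[volume] (reflect ⁻¹' halfSpace : Set Space) := by
      have h0 : ∀ᵐ x : Space, x 2 ≠ 0 := by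
        rw [ae_iff]; simpa using volume_boundary
      filter_upwards [h0] with x hx
      refine propext ?_
      change ¬ (0 < x 2) ↔ 0 < reflect x 2
      rw [reflect_apply, if_pos rfl, not_lt, neg_pos]
      exact ⟨fun h => h.lt_of_ne hx, le_of_lt⟩
    rw [setIntegral_congr_set he, ← (measurePreserving_reflect).setIntegral_preimage_emb
      reflect.toHomeomorph.measurableEmbedding (fun x => ‖u x‖ ^ 2) halfSpace]
    refine integral_congr_ae (ae_restrict_of_ae ?_)
    have h := coeFn_compIso reflect u
    rw [ho] at h
    filter_upwards [h, Lp.coeFn_neg u] with x h1 h2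
    rw [← h1, h2, Pi.neg_apply, norm_neg]
  rw [norm_rest_sq, norm_sq_eq_integral, h1,
    ← integral_add_compl measurableSet_halfSpace (integrable_norm_sq u), h2]
  ring

section

variable {L s : ℝ} (hL : 0 < L) (hs : 5 / 4 < s) (j : Fin 3)

lemma conj_derivSymb (L s : ℝ) (j : Fin 3) (k : Space) :
    conj (derivSymb L s j k) = derivSymb L s j (-k) := by
  simp [derivSymb, symb_neg, map_ofNat]

lemma conj_char (x k : Space) : conj (char x k) = char x (-k) := by
  simp only [char, ← Complex.exp_conj, map_mul, Complex.conj_ofReal, Complex.conj_I,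
    inner_neg_right]
  congr 1
  push_cast; ring

lemma char_reflect (x k : Space) : char (reflect x) k = char x (reflect k) := by
  have h : ⟪reflect x, k⟫_ℝ = ⟪x, reflect k⟫_ℝ := by
    conv_lhs => rw [← reflect_reflect k]
    exact reflect.inner_map_map _ _
  rw [char, char, h]

lemma derivSymb_reflect (L s : ℝ) {j : Fin 3} (hj : j ≠ 2) (k : Space) :
    derivSymb L s j (reflect k) = derivSymb L s j k := by
  rw [derivSymb, derivSymb, symb_reflect, reflect_apply, if_neg hj]

/-- Hermitian symmetry in `k`, which makes the inverse transform real-valued. -/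
lemma conjL2_pointHat (x : Space) :
    conjL2 (pointHat hL hs j x) = compIso (LinearIsometryEquiv.neg ℝ) (pointHat hL hs j x) := by
  refine Lp.ext ?_
  filter_upwards [coeFn_conjL2 (pointHat hL hs j x), coeFn_pointHat hL hs j x,
    coeFn_compIso (LinearIsometryEquiv.neg ℝ) (pointHat hL hs j x),
    (LinearIsometryEquiv.neg ℝ : Space ≃ₗᵢ[ℝ] Space).measurePreserving.quasiMeasurePreserving.ae
      (coeFn_pointHat hL hs j x)] with k h1 h2 h3 h4
  rw [h1, h2, h3, h4, map_mul, conj_derivSymb, conj_char]; rfl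

lemma compIso_reflect_pointHat (hj : j ≠ 2) (x : Space) :
    compIso reflect (pointHat hL hs j x) = pointHat hL hs j (reflect x) := by
  refine Lp.ext ?_
  filter_upwards [coeFn_compIso reflect (pointHat hL hs j x), coeFn_pointHat hL hs j (reflect x),
    measurePreserving_reflect.quasiMeasurePreserving.ae (coeFn_pointHat hL hs j x)] with k h1 h2 h3
  rw [h1, h2, h3, derivSymb_reflect _ _ hj, char_reflect]

/-- The inverse transform of the image kernel is real and odd, so Plancherel combines with
`norm_rest_sq_of_odd`. -/
lemma norm_rest_fourierInv_imageHat_sq (hj : j ≠ 2) (x : Space) :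
    ‖rest (𝓕⁻ (imageHat hL hs j x))‖ ^ 2 = ‖imageHat hL hs j x‖ ^ 2 / 2 := by
  have hn : ‖𝓕⁻ (imageHat hL hs j x)‖ = ‖imageHat hL hs j x‖ := by
    rw [← Lp.norm_fourier_eq, FourierTransform.fourier_fourierInv_eq]
  rw [← hn]
  refine norm_rest_sq_of_odd ?_ ?_
  · rw [← fourier_conjL2, ← fourier_compIso_neg, imageHat, map_sub, map_sub, conjL2_pointHat,
      conjL2_pointHat]
  · rw [← fourierInv_compIso, imageHat, map_sub, compIso_reflect_pointHat _ _ _ hj,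
      compIso_reflect_pointHat _ _ _ hj, reflect_reflect, ← FourierTransform.fourierInv_neg,
      neg_sub]

lemma norm_char_sub_char_reflect_sq (x k : Space) :
    ‖char x k - char (reflect x) k‖ ^ 2 = 2 - 2 * Real.cos (4 * Real.pi * x 2 * k 2) := by
  have h : ∀ a b : ℝ, ‖Complex.exp (a * Complex.I) - Complex.exp (b * Complex.I)‖ ^ 2 =
      2 - 2 * Real.cos (b - a) := by
    intro a b
    rw [Complex.sq_norm, Complex.normSq_apply, Complex.sub_re, Complex.sub_im,
      Complex.exp_ofReal_mul_I_re, Complex.exp_ofReal_mul_I_re, Complex.exp_ofReal_mul_I_im,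
      Complex.exp_ofReal_mul_I_im, Real.cos_sub]
    nlinarith [Real.sin_sq_add_cos_sq a, Real.sin_sq_add_cos_sq b]
  rw [char, char, h]
  congr 3
  rw [PiLp.inner_apply, PiLp.inner_apply, Fin.sum_univ_three, Fin.sum_univ_three]
  simp [reflect_apply]
  ring

lemma norm_imageHat_sq (x : Space) :
    ‖imageHat hL hs j x‖ ^ 2 = ∫ k : Space, symb L k ^ (-(2 * s)) *
      ((2 * Real.pi) ^ 2 * k j ^ 2) * (2 - 2 * Real.cos (4 * Real.pi * x 2 * k 2)) := by
  rw [norm_sq_eq_integral]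
  refine integral_congr_ae ?_
  filter_upwards [Lp.coeFn_sub (pointHat hL hs j x) (pointHat hL hs j (reflect x)),
    coeFn_pointHat hL hs j x, coeFn_pointHat hL hs j (reflect x)] with k e1 e2 e3
  rw [imageHat, e1, Pi.sub_apply, e2, e3, ← mul_sub, norm_mul, mul_pow, norm_derivSymb_sq,
    norm_char_sub_char_reflect_sq]

end

/-! ### The field `∇ × (φ e₃)` as a restriction of odd Schwartz functions. -/

/-- A real test function as a complex Schwartz function. -/
noncomputable def IsTest.toSchwartz {U : Set Space} {φ : Space → ℝ} (hφ : IsTest U φ) :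
    𝓢(Space, ℂ) :=
  HasCompactSupport.toSchwartzMap (f := fun x => (φ x : ℂ))
    (hφ.2.1.comp_left (g := fun r : ℝ => (r : ℂ)) Complex.ofReal_zero)
    (Complex.ofRealCLM.contDiff.comp hφ.1)

lemma IsTest.toSchwartz_apply {U : Set Space} {φ : Space → ℝ} (hφ : IsTest U φ) (x : Space) :
    hφ.toSchwartz x = (φ x : ℂ) := rfl

/-- The support of `φ` lies in the half-space, so the reflected term of the odd extension
contributes nothing there. -/
lemma IsTest.re_oddExt_lineDeriv {φ : Space → ℝ} (hφ : IsTest halfSpace φ) (i : Fin 3)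
    {x : Space} (hx : x ∈ halfSpace) :
    (oddExt (∂_{(EuclideanSpace.single i (1 : ℝ) : Space)} hφ.toSchwartz) x).re =
      VonKarman.partialDeriv i φ x := by
  have h : ∀ y, ((∂_{(EuclideanSpace.single i (1 : ℝ) : Space)} hφ.toSchwartz) y).re =
      VonKarman.partialDeriv i φ y := fun y => by
    rw [← fderiv_re_lineDeriv]; rfl
  have hx' : reflect x ∉ halfSpace := by
    have hx0 : 0 < x 2 := hx
    change ¬ (0 < reflect x 2)
    rw [reflect_apply, if_pos rfl]; linarith
  rw [oddExt, sub_apply, Complex.sub_re, reflectS_apply, h, h, (hφ.partialDeriv i).eq_zero hx',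
    sub_zero]

lemma partialDeriv_zero (i : Fin 3) (x : Space) : partialDeriv i 0 x = 0 := by
  simp [partialDeriv]

lemma curl_single_two (φ : Space → ℝ) (x : Space) :
    curl (Pi.single 2 φ) 0 x = partialDeriv 1 φ x ∧
      curl (Pi.single 2 φ) 1 x = -partialDeriv 0 φ x ∧ curl (Pi.single 2 φ) 2 x = 0 := by
  refine ⟨?_, ?_, ?_⟩ <;> simp [curl, partialDeriv_zero]

/-- The field `∇ × (φ e₃)` of `L²`. -/
noncomputable def curlField {φ : Space → ℝ} (hφ : IsTest halfSpace φ) : L2Vec :=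
  emb 0 ((oddExt (∂_{(EuclideanSpace.single 1 (1 : ℝ) : Space)} hφ.toSchwartz)).toLp 2) -
    emb 1 ((oddExt (∂_{(EuclideanSpace.single 0 (1 : ℝ) : Space)} hφ.toSchwartz)).toLp 2)

lemma coeFn_rest_oddExt {φ : Space → ℝ} (hφ : IsTest halfSpace φ) (i : Fin 3) :
    rest ((oddExt (∂_{(EuclideanSpace.single i (1 : ℝ) : Space)} hφ.toSchwartz)).toLp 2)
      =ᵐ[halfVol] partialDeriv i φ := by
  filter_upwards [coeFn_rest_toLp
    (oddExt (∂_{(EuclideanSpace.single i (1 : ℝ) : Space)} hφ.toSchwartz)),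
    ae_restrict_mem measurableSet_halfSpace] with x h1 h2
  rw [h1, hφ.re_oddExt_lineDeriv i h2]

lemma coeFn_curlField {φ : Space → ℝ} (hφ : IsTest halfSpace φ) (c : Fin 3) :
    ⇑(curlField hφ c) =ᵐ[halfVol] curl (Pi.single 2 φ) c := by
  have h0 := coeFn_rest_oddExt hφ 0
  have h1 := coeFn_rest_oddExt hφ 1
  fin_cases c
  · have e : curlField hφ 0 = rest ((oddExt (∂_{(EuclideanSpace.single 1 (1 : ℝ) : Space)}
        hφ.toSchwartz)).toLp 2) := by
      rw [curlField, PiLp.sub_apply, emb_apply, emb_apply]; simp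
    filter_upwards [h1] with x hx
    exact (by rw [e, hx, (curl_single_two φ x).1] :
      curlField hφ 0 x = curl (Pi.single 2 φ) 0 x)
  · have e : curlField hφ 1 = -rest ((oddExt (∂_{(EuclideanSpace.single 0 (1 : ℝ) : Space)}
        hφ.toSchwartz)).toLp 2) := by
      rw [curlField, PiLp.sub_apply, emb_apply, emb_apply]; simp
    filter_upwards [h0, Lp.coeFn_neg (rest ((oddExt
      (∂_{(EuclideanSpace.single 0 (1 : ℝ) : Space)} hφ.toSchwartz)).toLp 2))] with x hx hx'
    exact (by rw [e, hx', Pi.neg_apply, hx, (curl_single_two φ x).2.1] :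
      curlField hφ 1 x = curl (Pi.single 2 φ) 1 x)
  · have e : curlField hφ 2 = 0 := by
      rw [curlField, PiLp.sub_apply, emb_apply, emb_apply]; simp
    filter_upwards [Lp.coeFn_zero ℝ 2 halfVol] with x hx
    exact (by rw [e, hx, (curl_single_two φ x).2.2]; rfl :
      curlField hφ 2 x = curl (Pi.single 2 φ) 2 x)

lemma eq_curlField {φ : Space → ℝ} (hφ : IsTest halfSpace φ) {η : L2Vec}
    (hη : ∀ c, ⇑(η c) =ᵐ[halfVol] curl (Pi.single 2 φ) c) : η = curlField hφ :=
  PiLp.ext fun c => Lp.ext ((hη c).trans (coeFn_curlField hφ c).symm)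

lemma sub_mem_powGraph {G : Set (L2Vec × L2Vec)} (S : SpectralRep G) {α : ℝ} {φ f ψ g : L2Vec}
    (h1 : (φ, f) ∈ S.powGraph α) (h2 : (ψ, g) ∈ S.powGraph α) :
    (φ - ψ, f - g) ∈ S.powGraph α := by
  let _ := S.measY
  simp only [SpectralRep.powGraph, Set.mem_ofPred_eq, map_sub] at h1 h2 ⊢
  filter_upwards [h1, h2, Lp.coeFn_sub (S.U f) (S.U g), Lp.coeFn_sub (S.U φ) (S.U ψ)]
    with y e1 e2 e3 e4
  rw [e3, e4, Pi.sub_apply, Pi.sub_apply, e1, e2, mul_sub]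

/-! ### The random field `w`: existence, uniqueness and variance. -/

section Random

variable {Ω : Type*} [MeasurableSpace Ω] {P : Measure Ω}

/-- The strength `μ L^{17/6}` of the driving noise. -/
noncomputable def noiseStrength (L μ : ℝ) : ℝ :=
  μ * ((∏ _i : Fin 3, L) ^ (1 / 3 : ℝ)) ^ (17 / 6 : ℝ)

lemma noiseStrength_pos {L μ : ℝ} (hL : 0 < L) (hμ : 0 < μ) : 0 < noiseStrength L μ := by
  unfold noiseStrength; rw [Fin.prod_univ_three]; positivity

/-- This is where `κ` disappears: the test field has only components `0` and `1`, on which the power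
`17/12` is inverted by the multiplier. -/
lemma IsSolution.apply_curlField {L : ℝ} {κ : WithTop ℝ} {μ : ℝ}
    {ξ Ψ : L2Vec →L[ℝ] Lp ℝ 2 P} (h : IsSolution (fun _ => L) κ μ ξ Ψ) {φ : Space → ℝ}
    (hφ : IsTest halfSpace φ) :
    Ψ (curlField hφ) = noiseStrength L μ • ξ
      (emb 0 ((bessel L (17 / 12)
          (oddExt (∂_{(EuclideanSpace.single 1 (1 : ℝ) : Space)} hφ.toSchwartz))).toLp 2) -
        emb 1 ((bessel L (17 / 12)
          (oddExt (∂_{(EuclideanSpace.single 0 (1 : ℝ) : Space)} hφ.toSchwartz))).toLp 2)) := by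
  obtain ⟨S, hS⟩ := h
  exact hS _ _ (sub_mem_powGraph S
    (emb_bessel_mem_powGraph S (isOdd_oddExt _) (by decide) (by norm_num))
    (emb_bessel_mem_powGraph S (isOdd_oddExt _) (by decide) (by norm_num)))

lemma IsWhiteNoise.norm_sq {ξ : L2Vec →L[ℝ] Lp ℝ 2 P} (hξ : IsWhiteNoise ξ) (f : L2Vec) :
    ‖ξ f‖ ^ 2 = ‖f‖ ^ 2 := by
  have h1 : ‖ξ f‖ ^ 2 = ∫ a, (ξ f a) ^ 2 ∂P := by
    rw [← real_inner_self_eq_norm_sq, L2.inner_def]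
    simp [sq]
  have h2 : ∫ a, (ξ f a) ^ 2 ∂P = ∫ t, t ^ 2 ∂(P.map (ξ f)) :=
    (integral_map (Lp.aestronglyMeasurable _).aemeasurable
      (by fun_prop : AEStronglyMeasurable (fun t : ℝ => t ^ 2) _)).symm
  have h3 : ∫ t, t ^ 2 ∂(gaussianReal 0 (‖f‖₊ ^ 2)) = ‖f‖ ^ 2 := by
    have hv := variance_fun_id_gaussianReal (μ := 0) (v := ‖f‖₊ ^ 2)
    rw [variance_of_integral_eq_zero (by fun_prop) (by simp)] at hv
    simpa using hv
  rw [h1, h2, hξ f, h3]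

lemma reynoldsStress_eq_norm_sq (w : Space → Lp ℝ 2 P) (x : Space) :
    reynoldsStress w x = ‖w x‖ ^ 2 := by
  rw [← real_inner_self_eq_norm_sq, L2.inner_def, reynoldsStress]
  simp [sq]

lemma five_quarters_lt : (5 / 4 : ℝ) < 17 / 12 := by norm_num

/-- The kernel that represents `w` at the point `x` as a white noise integral. -/
noncomputable def fieldKernel {L : ℝ} (hL : 0 < L) (x : Space) : L2Vec :=
  emb 0 (𝓕⁻ (imageHat hL five_quarters_lt 1 x)) - emb 1 (𝓕⁻ (imageHat hL five_quarters_lt 0 x))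

lemma continuous_fieldKernel {L : ℝ} (hL : 0 < L) : Continuous (fieldKernel hL) := by
  have hF : Continuous fun u : Lp ℂ 2 (volume : Measure Space) => 𝓕⁻ u :=
    FourierTransform.continuous_fourierInv
  exact ((emb 0).continuous.comp (hF.comp (continuous_imageHat hL _ 1))).sub
    ((emb 1).continuous.comp (hF.comp (continuous_imageHat hL _ 0)))

lemma norm_emb_sub_emb_sq (u v : Lp ℂ 2 (volume : Measure Space)) :
    ‖emb 0 u - emb 1 v‖ ^ 2 = ‖rest u‖ ^ 2 + ‖rest v‖ ^ 2 := by
  rw [PiLp.norm_sq_eq_of_L2, Fin.sum_univ_three]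
  simp [PiLp.sub_apply, emb_apply]

lemma integral_smul_emb_imageHat {L : ℝ} (hL : 0 < L) {j : Fin 3} (hj : j ≠ 2) (c : Fin 3)
    {φ : Space → ℝ} (hφ : IsTest halfSpace φ) :
    Integrable (fun x => φ x • emb c (𝓕⁻ (imageHat hL five_quarters_lt j x))) ∧
    ∫ x, φ x • emb c (𝓕⁻ (imageHat hL five_quarters_lt j x)) =
      emb c ((bessel L (17 / 12)
        (oddExt (∂_{(EuclideanSpace.single j (1 : ℝ) : Space)} hφ.toSchwartz))).toLp 2) := by
  set Λ : Lp ℂ 2 (volume : Measure Space) →L[ℝ] L2Vec := (emb c) ∘L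
    ((FourierTransform.fourierInvCLM ℂ (Lp ℂ 2 (volume : Measure Space))).restrictScalars ℝ)
    with hΛ
  have happ : ∀ u, Λ u = emb c (𝓕⁻ u) := fun u => rfl
  have hi := integrable_smul_imageHat hL five_quarters_lt j hφ.toSchwartz
  have he : ∀ x, Λ (hφ.toSchwartz x • imageHat hL five_quarters_lt j x) =
      φ x • emb c (𝓕⁻ (imageHat hL five_quarters_lt j x)) := fun x => by
    rw [hφ.toSchwartz_apply, Complex.coe_smul, map_smul, happ]
  refine ⟨(Λ.integrable_comp hi).congr (ae_of_all _ he), ?_⟩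
  simp only [← he]
  rw [Λ.integral_comp_comm hi, integral_smul_imageHat hL five_quarters_lt j hj, happ,
    SchwartzMap.toLp_fourierInv_eq, FourierTransform.fourierInv_fourier_eq (F := 𝓢(Space, ℂ))]

/-- Superposing the kernels against `φ` gives `A ^ (-17/12)` of `∇ × (φ e₃)`, and the bounded map
`ξ` passes through the Bochner integral. -/
lemma IsSolution.isCurlComponent {L : ℝ} (hL : 0 < L) {κ : WithTop ℝ} {μ : ℝ}
    {ξ Ψ : L2Vec →L[ℝ] Lp ℝ 2 P} (h : IsSolution (fun _ => L) κ μ ξ Ψ) :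
    IsCurlComponent Ψ 2 fun x => noiseStrength L μ • ξ (fieldKernel hL x) := by
  have hc : Continuous fun x => ξ (fieldKernel hL x) :=
    ξ.continuous.comp (continuous_fieldKernel hL)
  refine ⟨(hc.const_smul (noiseStrength L μ)).continuousOn, fun φ hφ η hη => ?_⟩
  rw [eq_curlField hφ hη, h.apply_curlField hφ,
    setIntegral_eq_integral_of_forall_compl_eq_zero
      fun x hx => by rw [hφ.eq_zero hx, zero_smul]]
  obtain ⟨i1, e1⟩ := integral_smul_emb_imageHat hL (j := 1) (by decide) 0 hφ
  obtain ⟨i0, e0⟩ := integral_smul_emb_imageHat hL (j := 0) (by decide) 1 hφ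
  rw [← e1, ← e0, ← integral_sub i1 i0]
  have := ((noiseStrength L μ) • ξ).integral_comp_comm (i1.sub i0)
  simp only [Pi.sub_apply] at this
  rw [← smul_apply, ← this]
  refine integral_congr_ae (ae_of_all _ fun x => ?_)
  simp only [← smul_sub, map_smul, smul_apply, fieldKernel]

/-- The difference of two representatives integrates to zero against every test function, hence
vanishes almost everywhere, and by continuity everywhere. The variance may thus be computed from the
explicit field. -/
lemma IsCurlComponent.eqOn {Ψ : L2Vec →L[ℝ] Lp ℝ 2 P} {v w : Space → Lp ℝ 2 P}
    (hv : IsCurlComponent Ψ 2 v) (hw : IsCurlComponent Ψ 2 w) : Set.EqOn v w halfSpace := by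
  refine Measure.eqOn_open_of_ae_eq (μ := volume) ?_ isOpen_halfSpace hv.1 hw.1
  rw [EventuallyEq, ae_restrict_iff' measurableSet_halfSpace]
  have hz := IsOpen.ae_eq_zero_of_integral_contDiff_smul_eq_zero (μ := volume) isOpen_halfSpace
    (f := fun x => v x - w x) ((hv.1.sub hw.1).locallyIntegrableOn measurableSet_halfSpace)
    fun φ h1 h2 h3 => ?_
  · filter_upwards [hz] with x hx hm
    exact sub_eq_zero.1 (hx hm)
  have hφ : IsTest halfSpace φ := ⟨h1, h2, h3⟩
  have hi : ∀ u : Space → Lp ℝ 2 P, IsCurlComponent Ψ 2 u → Integrable fun x => φ x • u x :=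
    fun u hu => by
      rw [← integrableOn_iff_integrable_of_support_subset (s := tsupport φ)
        fun x hx => subset_tsupport φ fun h => hx (by simp [h])]
      exact (h1.continuous.continuousOn.smul (hu.1.mono h3)).integrableOn_compact h2
  have e : ∀ u : Space → Lp ℝ 2 P, IsCurlComponent Ψ 2 u →
      ∫ x, φ x • u x = Ψ (curlField hφ) := fun u hu => by
    rw [← hu.2 φ hφ _ (coeFn_curlField hφ), setIntegral_eq_integral_of_forall_compl_eq_zero
      fun x hx => by rw [hφ.eq_zero hx, zero_smul]]
  simp only [smul_sub]
  rw [integral_sub (hi v hv) (hi w hw), e v hv, e w hw, sub_self]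

lemma norm_fieldKernel_sq {L : ℝ} (hL : 0 < L) (x : Space) :
    ‖fieldKernel hL x‖ ^ 2 = (‖imageHat hL five_quarters_lt 0 x‖ ^ 2 +
      ‖imageHat hL five_quarters_lt 1 x‖ ^ 2) / 2 := by
  rw [fieldKernel, norm_emb_sub_emb_sq, norm_rest_fourierInv_imageHat_sq _ _ _ (by decide),
    norm_rest_fourierInv_imageHat_sq _ _ _ (by decide)]
  ring

lemma IsCurlComponent.reynoldsStress_eq {L : ℝ} (hL : 0 < L) {κ : WithTop ℝ} {μ : ℝ}
    {ξ Ψ : L2Vec →L[ℝ] Lp ℝ 2 P} (hξ : IsWhiteNoise ξ) (h : IsSolution (fun _ => L) κ μ ξ Ψ)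
    {w : Space → Lp ℝ 2 P} (hw : IsCurlComponent Ψ 2 w) {x : Space} (hx : x ∈ halfSpace) :
    reynoldsStress w x = noiseStrength L μ ^ 2 * ((‖imageHat hL five_quarters_lt 0 x‖ ^ 2 +
      ‖imageHat hL five_quarters_lt 1 x‖ ^ 2) / 2) := by
  rw [reynoldsStress_eq_norm_sq, hw.eqOn (h.isCurlComponent hL) hx, norm_smul, mul_pow,
    hξ.norm_sq, norm_fieldKernel_sq, Real.norm_eq_abs, sq_abs]

end Random

/-! ### Reduction of the variance to a one-dimensional integral. -/

lemma integral_sq_mul_exp_neg_mul_sq {b : ℝ} (hb : 0 < b) :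
    ∫ k : ℝ, k ^ 2 * Real.exp (-b * k ^ 2) = b ^ (-(3 / 2) : ℝ) * Real.Gamma (3 / 2) := by
  have h1 := integral_comp_abs (f := fun k : ℝ => k ^ 2 * Real.exp (-b * k ^ 2))
  simp only [sq_abs] at h1
  have h2 := integral_rpow_mul_exp_neg_mul_rpow (p := 2) (q := 2) (b := b) (by norm_num)
    (by norm_num) hb
  simp only [Real.rpow_two] at h2
  rw [h1, h2]
  norm_num
  ring

lemma integrable_exp_neg_mul_sq_mul_cos {b : ℝ} (hb : 0 < b) (c : ℝ) :
    Integrable fun k : ℝ => Real.exp (-b * k ^ 2) * Real.cos (c * k) := by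
  refine (integrable_exp_neg_mul_sq hb).mul_bdd (c := 1)
    (by fun_prop : Continuous fun k : ℝ => Real.cos (c * k)).aestronglyMeasurable
    (ae_of_all _ fun k => Real.abs_cos_le_one _)

lemma integral_exp_neg_mul_sq_mul_cos {b : ℝ} (hb : 0 < b) (c : ℝ) :
    ∫ k : ℝ, Real.exp (-b * k ^ 2) * Real.cos (c * k) =
      √(Real.pi / b) * Real.exp (-c ^ 2 / (4 * b)) := by
  have h := congrArg Complex.re (fourierIntegral_gaussian (b := (b : ℂ)) (by simpa) (c : ℂ))
  have hi : Integrable fun x : ℝ =>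
      Complex.exp (Complex.I * c * x) * Complex.exp (-b * (x : ℂ) ^ 2) := by
    refine (integrable_cexp_neg_mul_sq (b := (b : ℂ)) (by simpa)).bdd_mul (c := 1)
      (by fun_prop : Continuous fun x : ℝ => Complex.exp (Complex.I * c * x)).aestronglyMeasurable
      (ae_of_all _ fun x => ?_)
    rw [show Complex.I * (c : ℂ) * x = ((c * x : ℝ) : ℂ) * Complex.I by push_cast; ring,
      Complex.norm_exp_ofReal_mul_I]
  rw [← RCLike.re_eq_complex_re, ← integral_re hi] at h
  convert h using 1
  · refine integral_congr_ae (ae_of_all _ fun x => ?_)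
    dsimp only
    rw [show Complex.I * (c : ℂ) * x = ((c * x : ℝ) : ℂ) * Complex.I by push_cast; ring,
      show -(b : ℂ) * (x : ℂ) ^ 2 = ((-b * x ^ 2 : ℝ) : ℂ) by push_cast; ring,
      ← Complex.ofReal_exp, RCLike.re_eq_complex_re, Complex.re_mul_ofReal,
      Complex.exp_ofReal_mul_I_re, mul_comm]
  · rw [show -(c : ℂ) ^ 2 / (4 * b) = ((-c ^ 2 / (4 * b) : ℝ) : ℂ) by push_cast; ring,
      show (Real.pi : ℂ) / b = ((Real.pi / b : ℝ) : ℂ) by push_cast; ring,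
      show (1 / 2 : ℂ) = ((1 / 2 : ℝ) : ℂ) by push_cast; ring,
      ← Complex.ofReal_cpow (by positivity), ← Complex.ofReal_exp, ← Complex.ofReal_mul,
      RCLike.re_eq_complex_re, Complex.ofReal_re, Real.sqrt_eq_rpow]

lemma integral_exp_neg_mul_sq_mul_one_sub_cos {b : ℝ} (hb : 0 < b) (c : ℝ) :
    ∫ k : ℝ, Real.exp (-b * k ^ 2) * (2 - 2 * Real.cos (c * k)) =
      2 * √(Real.pi / b) * (1 - Real.exp (-c ^ 2 / (4 * b))) := by
  have h : ∀ k : ℝ, Real.exp (-b * k ^ 2) * (2 - 2 * Real.cos (c * k)) =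
      2 * Real.exp (-b * k ^ 2) - 2 * (Real.exp (-b * k ^ 2) * Real.cos (c * k)) := fun k => by ring
  simp only [h]
  rw [integral_sub ((integrable_exp_neg_mul_sq hb).const_mul 2)
    ((integrable_exp_neg_mul_sq_mul_cos hb c).const_mul 2), integral_const_mul, integral_const_mul,
    integral_exp_neg_mul_sq_mul_cos hb, integral_gaussian]
  ring

lemma integral_prod_coord (f : Fin 3 → ℝ → ℝ) :
    ∫ k : Space, f 0 (k 0) * f 1 (k 1) * f 2 (k 2) =
      (∫ t, f 0 t) * (∫ t, f 1 t) * ∫ t, f 2 t := by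
  rw [← (PiLp.volume_preserving_toLp (Fin 3)).integral_comp
    (MeasurableEquiv.toLp 2 (Fin 3 → ℝ)).measurableEmbedding]
  have := integral_fintype_prod_volume_eq_prod (ι := Fin 3) (E := fun _ => ℝ) f
  rw [Fin.prod_univ_three] at this
  rw [← this]
  simp only [Fin.prod_univ_three]

/-- The Gaussian integral on the Fourier side. -/
lemma integral_gaussian_moment {b : ℝ} (hb : 0 < b) (c : ℝ) {j : Fin 3} (hj : j ≠ 2) :
    ∫ k : Space, Real.exp (-b * ‖k‖ ^ 2) * (k j ^ 2 * (2 - 2 * Real.cos (c * k 2))) =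
      2 * Real.pi * Real.Gamma (3 / 2) * b ^ (-(5 / 2) : ℝ) *
        (1 - Real.exp (-c ^ 2 / (4 * b))) := by
  have hn : ∀ k : Space, Real.exp (-b * ‖k‖ ^ 2) =
      Real.exp (-b * k 0 ^ 2) * Real.exp (-b * k 1 ^ 2) * Real.exp (-b * k 2 ^ 2) := by
    intro k
    rw [← Real.exp_add, ← Real.exp_add, EuclideanSpace.norm_sq_eq, Fin.sum_univ_three]
    simp only [Real.norm_eq_abs, sq_abs]
    congr 1; ring
  have hval : b ^ (-(3 / 2) : ℝ) * Real.Gamma (3 / 2) * √(Real.pi / b) *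
      (2 * √(Real.pi / b) * (1 - Real.exp (-c ^ 2 / (4 * b)))) =
      2 * Real.pi * Real.Gamma (3 / 2) * b ^ (-(5 / 2) : ℝ) *
        (1 - Real.exp (-c ^ 2 / (4 * b))) := by
    have h1 : √(Real.pi / b) * √(Real.pi / b) = Real.pi * b⁻¹ :=
      (Real.mul_self_sqrt (by positivity)).trans (div_eq_mul_inv _ _)
    have h2 : b ^ (-(5 / 2) : ℝ) = b ^ (-(3 / 2) : ℝ) * b⁻¹ := by
      rw [← Real.rpow_neg_one b, ← Real.rpow_add hb]; norm_num
    rw [h2]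
    linear_combination (2 * b ^ (-(3 / 2) : ℝ) * Real.Gamma (3 / 2) *
      (1 - Real.exp (-c ^ 2 / (4 * b)))) * h1
  rw [← hval, ← integral_sq_mul_exp_neg_mul_sq hb, ← integral_exp_neg_mul_sq_mul_one_sub_cos hb,
    ← integral_gaussian]
  obtain rfl | rfl : j = 0 ∨ j = 1 := by
    fin_cases j <;> simp at hj ⊢
  · refine Eq.trans ?_ (integral_prod_coord ![fun k => k ^ 2 * Real.exp (-b * k ^ 2),
      fun k => Real.exp (-b * k ^ 2), fun k => Real.exp (-b * k ^ 2) * (2 - 2 * Real.cos (c * k))])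
    refine integral_congr_ae (ae_of_all _ fun k => ?_)
    simp only [hn, Matrix.cons_val]
    ring
  · rw [mul_comm (∫ k : ℝ, k ^ 2 * Real.exp (-b * k ^ 2))]
    refine Eq.trans ?_ (integral_prod_coord ![fun k => Real.exp (-b * k ^ 2),
      fun k => k ^ 2 * Real.exp (-b * k ^ 2),
      fun k => Real.exp (-b * k ^ 2) * (2 - 2 * Real.cos (c * k))])
    refine integral_congr_ae (ae_of_all _ fun k => ?_)
    simp only [hn, Matrix.cons_val]
    ring

lemma two_sub_two_cos_nonneg (x : ℝ) : 0 ≤ 2 - 2 * Real.cos x := by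
  linarith [Real.cos_le_one x]

lemma two_sub_two_cos_le (x : ℝ) : 2 - 2 * Real.cos x ≤ 4 := by
  linarith [Real.neg_one_le_cos x]

/-- The normalized variance integral. -/
noncomputable def varInt (r : ℝ) : ℝ :=
  ∫ t in Set.Ioi (0 : ℝ), t ^ (-(2 / 3) : ℝ) * Real.exp (-t) * (1 - Real.exp (-r ^ 2 / t))

/-- The constant in front of the variance integral. -/
noncomputable def varConst (L : ℝ) : ℝ :=
  (2 * Real.pi) ^ 2 / Real.Gamma (17 / 6) *
    (2 * Real.pi * Real.Gamma (3 / 2) * ((2 * Real.pi * L) ^ 2) ^ (-(5 / 2) : ℝ))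

lemma varConst_pos {L : ℝ} (hL : 0 < L) : 0 < varConst L := by
  have h1 := Real.Gamma_pos_of_pos (show (0 : ℝ) < 17 / 6 by norm_num)
  have h2 := Real.Gamma_pos_of_pos (show (0 : ℝ) < 3 / 2 by norm_num)
  have := Real.pi_pos
  unfold varConst
  positivity

/-- The power `symb ^ (-17/6)` is written as an integral of `exp (-symb t)` over `t`; after
exchanging integrals the `k`-integral is Gaussian. The exponent of `t` is `17/6 - 1 - 5/2 = -2/3`.
-/
lemma norm_imageHat_sq_eq {L : ℝ} (hL : 0 < L) {j : Fin 3} (hj : j ≠ 2) (x : Space) :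
    ‖imageHat hL five_quarters_lt j x‖ ^ 2 = varConst L * varInt (x 2 / L) := by
  have hΓ := Real.Gamma_pos_of_pos (show (0 : ℝ) < 17 / 6 by norm_num)
  have hπ := Real.pi_pos
  set c : ℝ := 4 * Real.pi * x 2 with hc
  set q : Space → ℝ := fun k => k j ^ 2 * (2 - 2 * Real.cos (c * k 2)) with hq
  have hq0 : ∀ k, 0 ≤ q k := fun k => mul_nonneg (sq_nonneg _) (two_sub_two_cos_nonneg _)
  have hqc : Continuous q := by rw [hq]; fun_prop
  set F : Space → ℝ → ℝ := fun k t => t ^ (17 / 6 - 1 : ℝ) * Real.exp (-(symb L k * t)) * q k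
    with hF
  have hFt : ∀ k, ∫ t in Set.Ioi (0 : ℝ), F k t =
      Real.Gamma (17 / 6) * (symb L k ^ (-(17 / 6) : ℝ) * q k) := by
    intro k
    rw [hF]; dsimp only
    rw [integral_mul_const,
      Real.integral_rpow_mul_exp_neg_mul_Ioi (by norm_num) (symb_pos L k), one_div,
      Real.inv_rpow (symb_pos L k).le, ← Real.rpow_neg (symb_pos L k).le]
    ring
  have hFi : ∀ k, IntegrableOn (F k) (Set.Ioi 0) := by
    intro k
    have := integrableOn_rpow_mul_exp_neg_mul_rpow (p := 1) (s := 17 / 6 - 1) (b := symb L k)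
      (by norm_num) (by norm_num) (symb_pos L k)
    refine (this.mul_const (q k)).congr (ae_of_all _ fun t => ?_)
    simp [hF]
  have hF0 : ∀ k, ∀ t ∈ Set.Ioi (0 : ℝ), 0 ≤ F k t := fun k t ht =>
    mul_nonneg (mul_nonneg (Real.rpow_nonneg (le_of_lt ht) _) (Real.exp_pos _).le) (hq0 k)
  -- As `F ≥ 0` for `t > 0`, it suffices that its `t`-integral be integrable in `k`; the bound `2 -
  -- 2 cos ≤ 4` compares it with `‖derivSymb‖²`.
  have hint : Integrable (Function.uncurry F)
      ((volume : Measure Space).prod (volume.restrict (Set.Ioi (0 : ℝ)))) := by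
    have hm : AEStronglyMeasurable (Function.uncurry F)
        ((volume : Measure Space).prod (volume.restrict (Set.Ioi (0 : ℝ)))) := by
      have hs := (continuous_symb L).measurable
      have hqm := hqc.measurable
      refine Measurable.aestronglyMeasurable ?_
      simp only [Function.uncurry_def, hF]
      fun_prop
    rw [integrable_prod_iff hm]
    refine ⟨ae_of_all _ fun k => hFi k, ?_⟩
    have he : ∀ k, ∫ t in Set.Ioi (0 : ℝ), ‖Function.uncurry F (k, t)‖ =
        Real.Gamma (17 / 6) * (symb L k ^ (-(17 / 6) : ℝ) * q k) := by
      intro k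
      rw [← hFt]
      refine setIntegral_congr_fun measurableSet_Ioi fun t ht => ?_
      exact abs_of_nonneg (hF0 k t ht)
    simp only [he]
    refine Integrable.const_mul ?_ _
    refine ((integrable_norm_derivSymb_sq hL five_quarters_lt j).mul_const
      (4 / (2 * Real.pi) ^ 2)).mono' ((continuous_symb_rpow L _).mul hqc).aestronglyMeasurable
      (ae_of_all _ fun k => ?_)
    have hs := Real.rpow_nonneg (symb_pos L k).le (-(17 / 6))
    rw [Real.norm_eq_abs, abs_of_nonneg (mul_nonneg hs (hq0 k)), norm_derivSymb_sq,
      show -(2 * (17 / 12) : ℝ) = -(17 / 6) by norm_num]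
    have e : symb L k ^ (-(17 / 6) : ℝ) * ((2 * Real.pi) ^ 2 * k j ^ 2) *
        (4 / (2 * Real.pi) ^ 2) = symb L k ^ (-(17 / 6) : ℝ) * (k j ^ 2 * 4) := by
      field_simp
    rw [e]
    exact mul_le_mul_of_nonneg_left
      (mul_le_mul_of_nonneg_left (two_sub_two_cos_le _) (sq_nonneg _)) hs
  have hswap := integral_integral_swap hint
  simp only [hFt, integral_const_mul] at hswap
  have hFk : ∀ t ∈ Set.Ioi (0 : ℝ), ∫ k, F k t =
      2 * Real.pi * Real.Gamma (3 / 2) * ((2 * Real.pi * L) ^ 2) ^ (-(5 / 2) : ℝ) *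
        (t ^ (-(2 / 3) : ℝ) * Real.exp (-t) * (1 - Real.exp (-(x 2 / L) ^ 2 / t))) := by
    intro t ht
    have ht : 0 < t := ht
    have e1 : ∀ k, F k t = t ^ (17 / 6 - 1 : ℝ) * Real.exp (-t) *
        (Real.exp (-((2 * Real.pi * L) ^ 2 * t) * ‖k‖ ^ 2) * q k) := by
      intro k
      simp only [hF, symb_eq]
      rw [show -((1 + (2 * Real.pi * L) ^ 2 * ‖k‖ ^ 2) * t) =
        -t + -((2 * Real.pi * L) ^ 2 * t) * ‖k‖ ^ 2 by ring, Real.exp_add]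
      ring
    simp only [e1]
    rw [integral_const_mul, integral_gaussian_moment (by positivity) c hj,
      Real.mul_rpow (by positivity) ht.le,
      show -c ^ 2 / (4 * ((2 * Real.pi * L) ^ 2 * t)) = -(x 2 / L) ^ 2 / t by
        rw [hc]; field_simp; ring,
      show (-(2 / 3) : ℝ) = (17 / 6 - 1) + -(5 / 2) by norm_num, Real.rpow_add ht]
    ring
  rw [setIntegral_congr_fun measurableSet_Ioi hFk, integral_const_mul] at hswap
  rw [norm_imageHat_sq, varConst, varInt, mul_assoc ((2 * Real.pi) ^ 2 / Real.Gamma (17 / 6)),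
    ← hswap,
    show -(2 * (17 / 12) : ℝ) = -(17 / 6) by norm_num]
  have e2 : ∀ k : Space, symb L k ^ (-(17 / 6) : ℝ) * ((2 * Real.pi) ^ 2 * k j ^ 2) *
      (2 - 2 * Real.cos (4 * Real.pi * x 2 * k 2)) =
      (2 * Real.pi) ^ 2 * (symb L k ^ (-(17 / 6) : ℝ) * q k) := fun k => by
    simp only [hq, hc]; ring
  simp only [e2]
  rw [integral_const_mul]
  field_simp

/-! ### The Matérn form and the asymptotics of the variance integral. -/

/-- An integral representation of the modified Bessel function of the second kind. -/
lemma integral_rpow_mul_exp_neg_sub_div {ν r : ℝ} (hν : 0 < ν) (hr : 0 < r) :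
    IntegrableOn (fun t : ℝ => t ^ (ν - 1) * Real.exp (-t - r ^ 2 / t)) (Set.Ioi 0) ∧
    ∫ t in Set.Ioi (0 : ℝ), t ^ (ν - 1) * Real.exp (-t - r ^ 2 / t) =
      2 * r ^ ν * besselK ν (2 * r) := by
  set g : ℝ → ℝ := fun t => t ^ (ν - 1) * Real.exp (-t - r ^ 2 / t) with hg
  have hI : IntegrableOn g (Set.Ioi 0) := by
    refine (Real.GammaIntegral_convergent hν).mono' ?_ ?_
    · exact Measurable.aestronglyMeasurable (by rw [hg]; fun_prop)
    · refine ae_restrict_of_forall_mem measurableSet_Ioi fun t ht => ?_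
      have ht : 0 < t := ht
      rw [Real.norm_eq_abs, abs_of_nonneg (by positivity), mul_comm (Real.exp (-t))]
      refine mul_le_mul_of_nonneg_left (Real.exp_le_exp.2 ?_) (by positivity)
      have : 0 ≤ r ^ 2 / t := by positivity
      linarith
  refine ⟨hI, ?_⟩
  -- The substitution `t = r eᵘ` turns `-t - r² / t` into `-2r cosh u`.
  set f : ℝ → ℝ := fun u => r * Real.exp u with hf
  have hd : ∀ u ∈ (Set.univ : Set ℝ), HasDerivWithinAt f (r * Real.exp u) Set.univ u := fun u _ =>
    ((Real.hasDerivAt_exp u).const_mul r).hasDerivWithinAt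
  have hinj : Set.InjOn f Set.univ := fun a _ b _ h =>
    Real.exp_injective (mul_left_cancel₀ hr.ne' h)
  have him : f '' Set.univ = Set.Ioi 0 := by
    ext t
    constructor
    · rintro ⟨u, -, rfl⟩
      exact mul_pos hr (Real.exp_pos u)
    · intro ht
      have ht : 0 < t := ht
      refine ⟨Real.log (t / r), trivial, ?_⟩
      rw [hf]; dsimp only
      rw [Real.exp_log (by positivity)]; field_simp
  have hcomp : ∀ u, |r * Real.exp u| • g (f u) =
      r ^ ν * (Real.exp (ν * u) * Real.exp (-(2 * r) * Real.cosh u)) := by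
    intro u
    have h1 : (r * Real.exp u) * (r * Real.exp u) ^ (ν - 1) = r ^ ν * Real.exp (ν * u) := by
      have hp : 0 < r * Real.exp u := by positivity
      rw [← Real.rpow_one_add' hp.le (by linarith), show 1 + (ν - 1) = ν by ring,
        Real.mul_rpow hr.le (Real.exp_pos u).le, ← Real.exp_mul, mul_comm u]
    have h2 : -(r * Real.exp u) - r ^ 2 / (r * Real.exp u) = -(2 * r) * Real.cosh u := by
      rw [Real.cosh_eq, Real.exp_neg]; field_simp; ring
    rw [abs_of_pos (by positivity), smul_eq_mul, hg, hf]
    dsimp only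
    rw [h2, ← mul_assoc, h1, mul_assoc]
  set G : ℝ → ℝ := fun u => Real.exp (ν * u) * Real.exp (-(2 * r) * Real.cosh u) with hG
  have hGi : Integrable G := by
    have := (integrableOn_image_iff_integrableOn_abs_deriv_smul MeasurableSet.univ hd hinj g).1
      (by rwa [him])
    simp only [hcomp] at this
    rw [integrableOn_univ] at this
    refine (this.const_mul (r ^ ν)⁻¹).congr (ae_of_all _ fun u => ?_)
    have : r ^ ν ≠ 0 := (Real.rpow_pos_of_pos hr ν).ne'
    dsimp only
    rw [inv_mul_cancel_left₀ this]
  have h1 := integral_image_eq_integral_abs_deriv_smul MeasurableSet.univ hd hinj g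
  rw [him] at h1
  simp only [hcomp] at h1
  rw [setIntegral_univ, integral_const_mul] at h1
  -- Averaging over `u ↦ -u` replaces `exp (ν u)` by `cosh (ν u)`; the even integrand then folds
  -- onto the half-line defining `besselK`.
  have h2 : ∫ u, G u = ∫ u, Real.exp (-(2 * r) * Real.cosh u) * Real.cosh (ν * u) := by
    have h3 : ∫ u, G (-u) = ∫ u, G u := integral_neg_eq_self G volume
    have h4 : ∫ u, (G u + G (-u)) = 2 * ∫ u, G u := by
      rw [integral_add hGi hGi.comp_neg, h3]; ring
    have h5 : ∀ u, G u + G (-u) =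
        2 * (Real.exp (-(2 * r) * Real.cosh u) * Real.cosh (ν * u)) := by
      intro u
      simp only [hG, Real.cosh_neg]
      rw [Real.cosh_eq (ν * u)]
      ring_nf
    simp only [h5] at h4
    rw [integral_const_mul] at h4
    linarith
  have h6 := integral_comp_abs
    (f := fun u : ℝ => Real.exp (-(2 * r) * Real.cosh u) * Real.cosh (ν * u))
  have h7 : ∀ u : ℝ, Real.cosh (ν * |u|) = Real.cosh (ν * u) := by
    intro u
    rcases abs_choice u with h | h <;> rw [h]
    rw [mul_neg, Real.cosh_neg]
  simp only [Real.cosh_abs, h7] at h6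
  rw [h1, h2, h6, besselK]
  ring

lemma integrableOn_varInt_majorant :
    IntegrableOn (fun t : ℝ => t ^ (-(2 / 3) : ℝ) * Real.exp (-t)) (Set.Ioi 0) := by
  refine (Real.GammaIntegral_convergent (s := 1 / 3) (by norm_num)).congr (ae_of_all _ fun t => ?_)
  dsimp only
  rw [mul_comm]; norm_num

lemma integral_varInt_majorant :
    ∫ t in Set.Ioi (0 : ℝ), t ^ (-(2 / 3) : ℝ) * Real.exp (-t) = Real.Gamma (1 / 3) := by
  rw [Real.Gamma_eq_integral (by norm_num)]
  refine integral_congr_ae (ae_of_all _ fun t => ?_)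
  dsimp only
  rw [mul_comm]; norm_num

lemma varInt_eq_matern {r : ℝ} (hr : 0 < r) :
    varInt r = Real.Gamma (1 / 3) * (1 - matern (1 / 3) (2 * r)) := by
  obtain ⟨hi, he⟩ := integral_rpow_mul_exp_neg_sub_div (ν := 1 / 3) (by norm_num) hr
  have hΓ : 0 < Real.Gamma (1 / 3) := Real.Gamma_pos_of_pos (by norm_num)
  rw [show (1 / 3 - 1 : ℝ) = -(2 / 3) by norm_num] at hi he
  have h1 : ∀ t : ℝ, t ^ (-(2 / 3) : ℝ) * Real.exp (-t) * (1 - Real.exp (-r ^ 2 / t)) =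
      t ^ (-(2 / 3) : ℝ) * Real.exp (-t) - t ^ (-(2 / 3) : ℝ) * Real.exp (-t - r ^ 2 / t) := by
    intro t
    rw [show -t - r ^ 2 / t = -t + -r ^ 2 / t by ring, Real.exp_add]; ring
  rw [varInt]
  simp only [h1]
  rw [integral_sub integrableOn_varInt_majorant hi, integral_varInt_majorant, he, matern]
  have h2 : (2 : ℝ) ^ (1 / 3 : ℝ) = 2 * 2 ^ (1 / 3 - 1 : ℝ) := by
    rw [Real.rpow_sub_one (by norm_num)]; ring
  have h3 : (0 : ℝ) < 2 ^ (1 / 3 - 1 : ℝ) := by positivity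
  rw [Real.mul_rpow (by norm_num) hr.le, h2]
  field_simp

lemma tendsto_varInt_atTop : Tendsto varInt atTop (𝓝 (Real.Gamma (1 / 3))) := by
  rw [← integral_varInt_majorant]
  refine tendsto_integral_filter_of_dominated_convergence _ (Eventually.of_forall fun r => ?_)
    (Eventually.of_forall fun r => ?_) integrableOn_varInt_majorant ?_
  · exact Measurable.aestronglyMeasurable (by fun_prop)
  · refine ae_restrict_of_forall_mem measurableSet_Ioi fun t ht => ?_
    have ht : 0 < t := ht
    have h1 : Real.exp (-r ^ 2 / t) ≤ 1 := Real.exp_le_one_iff.2 <|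
      div_nonpos_of_nonpos_of_nonneg (neg_nonpos.2 (sq_nonneg r)) ht.le
    have h2 := Real.exp_pos (-r ^ 2 / t)
    rw [norm_mul, Real.norm_of_nonneg (by positivity : 0 ≤ t ^ (-(2 / 3) : ℝ) * Real.exp (-t))]
    refine mul_le_of_le_one_right (by positivity) ?_
    rw [Real.norm_eq_abs, abs_le]; constructor <;> linarith
  · refine ae_restrict_of_forall_mem measurableSet_Ioi fun t ht => ?_
    have ht : 0 < t := ht
    have h1 : Tendsto (fun r : ℝ => -r ^ 2 / t) atTop atBot :=
      (tendsto_neg_atTop_atBot.comp (tendsto_pow_atTop two_ne_zero)).atBot_div_const ht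
    have h2 := ((Real.tendsto_exp_atBot.comp h1).const_sub 1).const_mul
      (t ^ (-(2 / 3) : ℝ) * Real.exp (-t))
    simpa using h2

lemma one_sub_exp_neg_nonneg {r : ℝ} (hr : 0 < r) : 0 ≤ 1 - Real.exp (-r) :=
  sub_nonneg.2 (Real.exp_le_one_iff.2 (neg_nonpos.2 hr.le))

lemma one_sub_exp_neg_le (r : ℝ) : 1 - Real.exp (-r) ≤ r := by
  have := Real.add_one_le_exp (-r); linarith

lemma integrableOn_rpow_mul_one_sub_exp_neg :
    IntegrableOn (fun r : ℝ => r ^ (-(4 / 3) : ℝ) * (1 - Real.exp (-r))) (Set.Ioi 0) := by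
  rw [← Set.Ioc_union_Ioi_eq_Ioi (zero_le_one' ℝ), integrableOn_union]
  have hm : Measurable fun r : ℝ => r ^ (-(4 / 3) : ℝ) * (1 - Real.exp (-r)) := by fun_prop
  constructor
  · have h : IntegrableOn (fun r : ℝ => r ^ (-(1 / 3) : ℝ)) (Set.Ioc 0 1) :=
      (intervalIntegrable_iff_integrableOn_Ioc_of_le zero_le_one).1
        (intervalIntegral.intervalIntegrable_rpow' (by norm_num))
    refine h.mono' hm.aestronglyMeasurable
      (ae_restrict_of_forall_mem measurableSet_Ioc fun r hr => ?_)
    rw [Real.norm_of_nonneg (mul_nonneg (Real.rpow_nonneg hr.1.le _)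
      (one_sub_exp_neg_nonneg hr.1))]
    calc r ^ (-(4 / 3) : ℝ) * (1 - Real.exp (-r)) ≤ r ^ (-(4 / 3) : ℝ) * r :=
          mul_le_mul_of_nonneg_left (one_sub_exp_neg_le r) (Real.rpow_nonneg hr.1.le _)
      _ = r ^ (-(1 / 3) : ℝ) := by rw [← Real.rpow_add_one hr.1.ne']; norm_num
  · refine (integrableOn_Ioi_rpow_of_lt (a := -(4 / 3)) (by norm_num) one_pos).mono'
      hm.aestronglyMeasurable (ae_restrict_of_forall_mem measurableSet_Ioi fun r hr => ?_)
    have hr0 : 0 < r := one_pos.trans hr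
    rw [Real.norm_of_nonneg (mul_nonneg (Real.rpow_nonneg hr0.le _)
      (one_sub_exp_neg_nonneg hr0))]
    refine mul_le_of_le_one_right (Real.rpow_nonneg hr0.le _) ?_
    linarith [Real.exp_pos (-r)]

/-- Integration by parts with the antiderivative `-3 r ^ (-1/3)` of `r ^ (-4/3)`. The boundary terms
are `O(r ^ (2/3))` at zero and `O(r ^ (-1/3))` at infinity. -/
lemma integral_rpow_mul_one_sub_exp_neg :
    ∫ r in Set.Ioi (0 : ℝ), r ^ (-(4 / 3) : ℝ) * (1 - Real.exp (-r)) =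
      3 * Real.Gamma (2 / 3) := by
  have hG : IntegrableOn (fun r : ℝ => Real.exp (-r) * r ^ (-(1 / 3) : ℝ)) (Set.Ioi 0) := by
    refine (Real.GammaIntegral_convergent (s := 2 / 3) (by norm_num)).congr
      (ae_of_all _ fun t => ?_)
    norm_num
  have hG' : ∫ r in Set.Ioi (0 : ℝ), Real.exp (-r) * r ^ (-(1 / 3) : ℝ) = Real.Gamma (2 / 3) := by
    rw [Real.Gamma_eq_integral (by norm_num)]
    norm_num
  have key := integral_Ioi_mul_deriv_eq_deriv_mul (a := (0 : ℝ)) (a' := (0 : ℝ)) (b' := (0 : ℝ))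
    (u := fun r : ℝ => 1 - Real.exp (-r)) (u' := fun r => Real.exp (-r))
    (v := fun r : ℝ => -3 * r ^ (-(1 / 3) : ℝ)) (v' := fun r : ℝ => r ^ (-(4 / 3) : ℝ))
    (fun r _ => by simpa using ((Real.hasDerivAt_exp (-r)).comp r (hasDerivAt_neg r)).const_sub 1)
    (fun r hr => by
      have := (Real.hasDerivAt_rpow_const (x := r) (p := -(1 / 3))
        (Or.inl (ne_of_gt hr))).const_mul (-3)
      convert this using 1
      rw [show (-(1 / 3) - 1 : ℝ) = -(4 / 3) by norm_num]; ring)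
    (integrableOn_rpow_mul_one_sub_exp_neg.congr (ae_of_all _ fun r => mul_comm _ _))
    ((hG.const_mul (-3)).congr (ae_of_all _ fun r => by simp only [Pi.mul_apply]; ring))
    ?_ ?_
  · have e1 : ∀ r : ℝ, r ^ (-(4 / 3) : ℝ) * (1 - Real.exp (-r)) =
        (1 - Real.exp (-r)) * r ^ (-(4 / 3) : ℝ) := fun r => mul_comm _ _
    have e2 : ∀ r : ℝ, Real.exp (-r) * (-3 * r ^ (-(1 / 3) : ℝ)) =
        -3 * (Real.exp (-r) * r ^ (-(1 / 3) : ℝ)) := fun r => by ring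
    simp only [e1]
    rw [key]
    simp only [e2]
    rw [integral_const_mul, hG']
    ring
  · have hlim : Tendsto (fun r : ℝ => 3 * r ^ (2 / 3 : ℝ)) (𝓝[>] 0) (𝓝 0) := by
      have : Tendsto (fun r : ℝ => 3 * r ^ (2 / 3 : ℝ)) (𝓝 0) (𝓝 (3 * 0 ^ (2 / 3 : ℝ))) :=
        ((Real.continuous_rpow_const (by norm_num)).tendsto 0).const_mul 3
      rw [Real.zero_rpow (by norm_num), mul_zero] at this
      exact this.mono_left nhdsWithin_le_nhds
    refine squeeze_zero_norm' ?_ hlim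
    filter_upwards [self_mem_nhdsWithin] with r hr
    have hr : 0 < r := hr
    rw [Pi.mul_apply, norm_mul, norm_mul, Real.norm_of_nonneg (one_sub_exp_neg_nonneg hr),
      Real.norm_of_nonneg (Real.rpow_nonneg hr.le _)]
    calc (1 - Real.exp (-r)) * (‖(-3 : ℝ)‖ * r ^ (-(1 / 3) : ℝ))
        ≤ r * (‖(-3 : ℝ)‖ * r ^ (-(1 / 3) : ℝ)) :=
          mul_le_mul_of_nonneg_right (one_sub_exp_neg_le r) (by positivity)
      _ = 3 * (r ^ (-(1 / 3) : ℝ) * r) := by norm_num; ring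
      _ = 3 * r ^ (2 / 3 : ℝ) := by rw [← Real.rpow_add_one hr.ne']; norm_num
  · have h1 : Tendsto (fun r : ℝ => 1 - Real.exp (-r)) atTop (𝓝 (1 - 0)) :=
      (Real.tendsto_exp_neg_atTop_nhds_zero).const_sub 1
    have h2 : Tendsto (fun r : ℝ => -3 * r ^ (-(1 / 3) : ℝ)) atTop (𝓝 (-3 * 0)) :=
      (tendsto_rpow_neg_atTop (by norm_num)).const_mul _
    have := h1.mul h2
    rw [mul_zero, mul_zero] at this
    exact this

/-- The substitution `t = s² / r` exchanges the two exponentials and pulls out the power of `s`; the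
remaining integral has a finite positive limit as `s → 0`. -/
lemma varInt_eq_rpow_mul {s : ℝ} (hs : 0 < s) :
    varInt s = s ^ (2 / 3 : ℝ) *
      ∫ r in Set.Ioi (0 : ℝ), r ^ (-(4 / 3) : ℝ) * (1 - Real.exp (-r)) * Real.exp (-s ^ 2 / r) := by
  set f : ℝ → ℝ := fun r => s ^ 2 / r with hf
  have hd : ∀ r ∈ Set.Ioi (0 : ℝ), HasDerivWithinAt f (-(s ^ 2 / r ^ 2)) (Set.Ioi 0) r := by
    intro r hr
    have h : HasDerivAt f (s ^ 2 * -(r ^ 2)⁻¹) r :=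
      (hasDerivAt_inv (ne_of_gt hr)).const_mul (s ^ 2)
    rw [mul_neg, ← div_eq_mul_inv] at h
    exact h.hasDerivWithinAt
  have hinj : Set.InjOn f (Set.Ioi 0) := by
    intro a ha b hb h
    have ha : 0 < a := ha
    have hb : 0 < b := hb
    simp only [hf] at h
    field_simp at h
    exact h.symm
  have him : f '' Set.Ioi 0 = Set.Ioi 0 := by
    ext t
    constructor
    · rintro ⟨u, hu, rfl⟩
      have hu : 0 < u := hu
      exact div_pos (by positivity) hu
    · intro ht
      have ht : 0 < t := ht
      refine ⟨s ^ 2 / t, div_pos (by positivity) ht, ?_⟩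
      simp only [hf]; field_simp
  have h := integral_image_eq_integral_abs_deriv_smul measurableSet_Ioi hd hinj
    (fun t => t ^ (-(2 / 3) : ℝ) * Real.exp (-t) * (1 - Real.exp (-s ^ 2 / t)))
  rw [him] at h
  rw [varInt, h, ← integral_const_mul]
  refine setIntegral_congr_fun measurableSet_Ioi fun r hr => ?_
  have hr : 0 < r := hr
  simp only [hf, smul_eq_mul, abs_neg]
  have e1 : -s ^ 2 / (s ^ 2 / r) = -r := by field_simp
  have e2 : (s ^ 2 / r) ^ (-(2 / 3) : ℝ) = s ^ (-(4 / 3) : ℝ) * r ^ (2 / 3 : ℝ) := by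
    rw [Real.div_rpow (by positivity) hr.le, ← Real.rpow_natCast_mul hs.le,
      Real.rpow_neg hr.le, div_inv_eq_mul]
    norm_num
  have e3 : s ^ (2 / 3 : ℝ) = s ^ (-(4 / 3) : ℝ) * s ^ 2 := by
    rw [← Real.rpow_two, ← Real.rpow_add hs]; norm_num
  have e4 : r ^ (2 / 3 : ℝ) = r ^ (-(4 / 3) : ℝ) * r ^ 2 := by
    rw [← Real.rpow_two, ← Real.rpow_add hr]; norm_num
  rw [e1, e2, e3, e4, abs_of_pos (by positivity), ← neg_div]
  field_simp

lemma tendsto_varInt_div_rpow :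
    Tendsto (fun s : ℝ => varInt s / s ^ (2 / 3 : ℝ)) (𝓝[>] 0)
      (𝓝 (3 * Real.Gamma (2 / 3))) := by
  have h : Tendsto (fun s : ℝ => ∫ r in Set.Ioi (0 : ℝ),
      r ^ (-(4 / 3) : ℝ) * (1 - Real.exp (-r)) * Real.exp (-s ^ 2 / r)) (𝓝[>] 0)
      (𝓝 (3 * Real.Gamma (2 / 3))) := by
    rw [← integral_rpow_mul_one_sub_exp_neg]
    refine tendsto_integral_filter_of_dominated_convergence _ (Eventually.of_forall fun s => ?_)
      (Eventually.of_forall fun s => ?_) integrableOn_rpow_mul_one_sub_exp_neg ?_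
    · exact Measurable.aestronglyMeasurable (by fun_prop)
    · refine ae_restrict_of_forall_mem measurableSet_Ioi fun r hr => ?_
      have hr : 0 < r := hr
      have h0 := mul_nonneg (Real.rpow_nonneg hr.le (-(4 / 3))) (one_sub_exp_neg_nonneg hr)
      rw [norm_mul, Real.norm_of_nonneg h0, Real.norm_of_nonneg (Real.exp_pos _).le]
      exact mul_le_of_le_one_right h0 (Real.exp_le_one_iff.2 <|
        div_nonpos_of_nonpos_of_nonneg (neg_nonpos.2 (sq_nonneg s)) hr.le)
    · refine ae_restrict_of_forall_mem measurableSet_Ioi fun r _ => ?_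
      have hc : Continuous fun s : ℝ =>
          r ^ (-(4 / 3) : ℝ) * (1 - Real.exp (-r)) * Real.exp (-s ^ 2 / r) := by fun_prop
      have := (hc.tendsto 0).mono_left (nhdsWithin_le_nhds (s := Set.Ioi 0))
      simpa using this
  refine h.congr' ?_
  filter_upwards [self_mem_nhdsWithin] with s hs
  have hs : 0 < s := hs
  rw [varInt_eq_rpow_mul hs, mul_div_cancel_left₀ _ (Real.rpow_pos_of_pos hs _).ne']

/-- Boundary asymptotics of the normalized variance. -/
lemma varInt_div_gamma_isEquivalent :
    (fun s : ℝ => varInt s / Real.Gamma (1 / 3)) ~[𝓝[>] 0]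
      fun s : ℝ => Real.Gamma (2 / 3) / Real.Gamma (4 / 3) * s ^ (2 / 3 : ℝ) := by
  have hΓ1 : 0 < Real.Gamma (1 / 3) := Real.Gamma_pos_of_pos (by norm_num)
  have hΓ2 : 0 < Real.Gamma (2 / 3) := Real.Gamma_pos_of_pos (by norm_num)
  -- The factor `3` in the limit `3 Γ(2/3)` is absorbed here, since `Γ(1/3) = 3 Γ(4/3)`.
  have h43 : Real.Gamma (4 / 3) = 1 / 3 * Real.Gamma (1 / 3) := by
    rw [← Real.Gamma_add_one (by norm_num)]; norm_num
  refine isEquivalent_of_tendsto_one ?_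
  have h := tendsto_varInt_div_rpow.div_const (3 * Real.Gamma (2 / 3))
  rw [div_self (by positivity)] at h
  refine h.congr' ?_
  filter_upwards [self_mem_nhdsWithin] with s hs
  have hs : 0 < s := hs
  have := Real.rpow_pos_of_pos hs (2 / 3)
  rw [Pi.div_apply, h43]
  field_simp

end VonKarman

theorem mainTheorem1 (μ Linf : ℝ) (hμ : 0 < μ) (hL : 0 < Linf) :
    ∃ wInfSq : ℝ, 0 < wInfSq ∧
      ∀ (κ : WithTop ℝ) (Ω : Type*) [MeasurableSpace Ω] (P : Measure Ω) [IsProbabilityMeasure P]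
        (ξ Ψ : VonKarman.L2Vec →L[ℝ] Lp ℝ 2 P),
        VonKarman.IsWhiteNoise ξ →
        VonKarman.IsSolution (fun _ => Linf) κ μ ξ Ψ →
        (∃ w : VonKarman.Space → Lp ℝ 2 P, VonKarman.IsCurlComponent Ψ 2 w) ∧
        ∀ w : VonKarman.Space → Lp ℝ 2 P, VonKarman.IsCurlComponent Ψ 2 w →
          (∀ x y : ℝ,
            Tendsto (fun z : ℝ => VonKarman.reynoldsStress w !₂[x, y, z]) atTop (𝓝 wInfSq)) ∧
          (∀ x y z : ℝ, 0 < z →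
            VonKarman.reynoldsStress w !₂[x, y, z] / wInfSq =
              1 - VonKarman.matern (1 / 3) (2 * z / Linf)) ∧
          (∀ x y : ℝ,
            (fun s : ℝ => VonKarman.reynoldsStress w !₂[x, y, Linf * s] / wInfSq)
              ~[𝓝[>] 0]
            fun s : ℝ => Real.Gamma (2 / 3) / Real.Gamma (4 / 3) * s ^ (2 / 3 : ℝ)) := by
  have hΓ : 0 < Real.Gamma (1 / 3) := Real.Gamma_pos_of_pos (by norm_num)
  have hD : 0 < VonKarman.noiseStrength Linf μ ^ 2 * VonKarman.varConst Linf :=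
    mul_pos (pow_pos (VonKarman.noiseStrength_pos hL hμ) 2) (VonKarman.varConst_pos hL)
  set D := VonKarman.noiseStrength Linf μ ^ 2 * VonKarman.varConst Linf with hDdef
  -- The limit is fixed before `κ`, the probability space and the solution are introduced; `D`
  -- involves only `μ` and `Linf`.
  refine ⟨D * Real.Gamma (1 / 3), mul_pos hD hΓ, ?_⟩
  intro κ Ω _ P _ ξ Ψ hξ hΨ
  refine ⟨⟨_, hΨ.isCurlComponent hL⟩, fun w hw => ?_⟩
  -- The two horizontal derivatives contribute equally, cancelling the factor `1/2` from the
  -- half-space energy.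
  have hR : ∀ x y z : ℝ, 0 < z →
      VonKarman.reynoldsStress w !₂[x, y, z] = D * VonKarman.varInt (z / Linf) := by
    intro x y z hz
    rw [hw.reynoldsStress_eq hL hξ hΨ (x := !₂[x, y, z]) hz,
      VonKarman.norm_imageHat_sq_eq hL (by decide), VonKarman.norm_imageHat_sq_eq hL (by decide),
      hDdef]
    simp
    ring
  refine ⟨fun x y => ?_, fun x y z hz => ?_, fun x y => ?_⟩
  · refine ((VonKarman.tendsto_varInt_atTop.comp
      (tendsto_id.atTop_div_const hL)).const_mul D).congr' ?_
    filter_upwards [eventually_gt_atTop 0] with z hz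
    rw [hR x y z hz]; rfl
  · rw [hR x y z hz, mul_div_mul_left _ _ hD.ne', VonKarman.varInt_eq_matern (div_pos hz hL),
      mul_div_cancel_left₀ _ hΓ.ne', mul_div_assoc]
  · refine VonKarman.varInt_div_gamma_isEquivalent.congr_left ?_
    filter_upwards [self_mem_nhdsWithin] with s hs
    rw [hR x y _ (mul_pos hL hs), mul_div_mul_left _ _ hD.ne', mul_div_cancel_left₀ _ hL.ne']
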